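/- Let $N\ge 2$ be an integer and $f:\mathbb R\to\mathbb R$ a function. Put $F(t)=\int_0^t f(s)\,ds$, and consider the following assumptions: (f1) $f(0)=0$; (f2) $f$ is locally Lipschitz in $[0,+\infty)$; (f3) $\alpha:=\inf\{\xi>0 \mid f(\xi)\ge 0\}$ exists and $\alpha>0$; (f4) $\lim_{s\to\alpha^+}\frac{f(s)}{s-\alpha}$ exists and is positive; (f5) there is $\gamma>0$ such that $F(\gamma)>0$; (f6) $f(\xi)>0$ for every $\xi\in(\alpha,\xi_0]$, where $\xi_0:=\inf\{\xi>0\mid F(\xi)>0\}$. Suppose that either $N\ge 3$ and $f$ satisfies (f1)–(f6), or $N=2$ and $f$ satisfies (f1), (f2), (f3), (f5), (f6). Then the problem $$\operatorname{div}\left(\frac{\nabla u}{\sqrt{1-|\nabla u|^2}}\right)+f(u)=0,\qquad u>0\quad\text{in }\mathbb R^N,\qquad u(x)\to 0\ \text{ as }|x|\to\infty,$$ has a radially decreasing classical solution; that is, there is $u\in C^2(\mathbb R^N)$ with $|\nabla u|<1$ everywhere that satisfies the problem pointwise and is of the form $u(x)=v(|x|)$ with $v$ strictly decreasing on $[0,+\infty)$.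 -/

import Mathlib

/-- The primitive of `f` vanishing at the origin, `F(t) = ∫₀ᵗ f(s) ds`. -/
noncomputable def primitiveF (f : ℝ → ℝ) (t : ℝ) : ℝ :=
  ∫ s in (0 : ℝ)..t, f s

/-- `α = inf {ξ > 0 | f(ξ) ≥ 0}`. (The real infimum of the empty set is `0`, so that
`0 < alphaOf f` also says that the set is nonempty.) -/
noncomputable def alphaOf (f : ℝ → ℝ) : ℝ :=
  sInf {ξ : ℝ | 0 < ξ ∧ 0 ≤ f ξ}

/-- `ξ₀ = inf {ξ > 0 | F(ξ) > 0}`. -/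
noncomputable def xiZero (f : ℝ → ℝ) : ℝ :=
  sInf {ξ : ℝ | 0 < ξ ∧ 0 < primitiveF f ξ}

/-- (f1): `f(0) = 0`. -/
def CondF1 (f : ℝ → ℝ) : Prop := f 0 = 0

/-- (f2): `f` is locally Lipschitz in `[0, +∞)`. -/
def CondF2 (f : ℝ → ℝ) : Prop := LocallyLipschitzOn (Set.Ici (0 : ℝ)) f

/-- (f3): `α = inf {ξ > 0 | f(ξ) ≥ 0}` exists and is positive. -/
def CondF3 (f : ℝ → ℝ) : Prop := 0 < alphaOf f

/-- (f4): the limit of `f(s) / (s - α)` as `s → α⁺` exists and is positive. -/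
def CondF4 (f : ℝ → ℝ) : Prop :=
  ∃ L : ℝ, 0 < L ∧
    Filter.Tendsto (fun s => f s / (s - alphaOf f)) (nhdsWithin (alphaOf f) (Set.Ioi (alphaOf f)))
      (nhds L)

/-- (f5): `F(γ) > 0` for some `γ > 0`. -/
def CondF5 (f : ℝ → ℝ) : Prop := ∃ γ : ℝ, 0 < γ ∧ 0 < primitiveF f γ

/-- (f6): `f > 0` in `(α, ξ₀]`. -/
def CondF6 (f : ℝ → ℝ) : Prop := ∀ ξ ∈ Set.Ioc (alphaOf f) (xiZero f), 0 < f ξ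

/-- The divergence `∑ᵢ ∂ᵢ Xᵢ` of a vector field on `ℝᴺ`. -/
noncomputable def divergence {N : ℕ}
    (X : EuclideanSpace ℝ (Fin N) → EuclideanSpace ℝ (Fin N))
    (x : EuclideanSpace ℝ (Fin N)) : ℝ :=
  ∑ i : Fin N, (fderiv ℝ X x (EuclideanSpace.single i (1 : ℝ))) i

/-- The vector field `∇u / √(1 - |∇u|²)`. -/
noncomputable def minkowskiFlux {N : ℕ} (u : EuclideanSpace ℝ (Fin N) → ℝ)
    (x : EuclideanSpace ℝ (Fin N)) : EuclideanSpace ℝ (Fin N) :=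
  (Real.sqrt (1 - ‖gradient u x‖ ^ 2))⁻¹ • gradient u x

/-- A classical solution of
`div (∇u / √(1 - |∇u|²)) + f(u) = 0` and `u > 0` in `ℝᴺ`, `u(x) → 0` as `|x| → ∞`.
It is of class `C²` with `|∇u| < 1` everywhere, so that the flux is a `C¹` vector field. -/
structure IsGroundState {N : ℕ} (f : ℝ → ℝ) (u : EuclideanSpace ℝ (Fin N) → ℝ) : Prop where
  contDiff : ContDiff ℝ 2 u
  norm_gradient_lt : ∀ x, ‖gradient u x‖ < 1
  equation : ∀ x, divergence (minkowskiFlux u) x + f (u x) = 0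
  pos : ∀ x, 0 < u x
  tendsto_zero : Filter.Tendsto u (Filter.comap norm Filter.atTop) (nhds 0)

/-- `u(x) = v(|x|)` for a strictly decreasing profile `v` on `[0, +∞)`. -/
def IsRadiallyDecreasing {N : ℕ} (u : EuclideanSpace ℝ (Fin N) → ℝ) : Prop :=
  ∃ v : ℝ → ℝ, StrictAntiOn v (Set.Ici (0 : ℝ)) ∧ ∀ x, u x = v ‖x‖

/-!
A radial function `u(x) = v(|x|)` solves the equation in `ℝⁿ⁺¹` exactly when its reversed flux
`p = -v' / √(1 - v'²)` satisfies `v' = -p / √(1 + p²)` and `p' = k(v) - (n / r) p`, where `k` is the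
nonlinearity; a profile `v` is found by shooting from the central value `ξ = v(0)`. Here `k` is `f`
frozen outside an interval `[0, M]` that contains the values of the solution, hence globally
Lipschitz. In integrated form the equation has no singularity at `r = 0`, and the Banach fixed point
theorem in an exponentially weighted space gives a global profile for each `ξ`, depending
continuously on `ξ` (`exists_radialProfile`).

The energy `E = √(1 + p²) - 1 + ∫₀ᵛ k` is nonincreasing in `r`. Among the `ξ` in `(α, β)`, where `β`
is `M` or the first zero of `f` beyond `α`, two sets are open and disjoint: the `ξ` whose profile
becomes negative, and the `ξ` whose energy becomes negative while the profile is still positive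
(below zero the potential vanishes, so the energy is nonnegative there). If `ξ` is in neither set,
then `v > 0` and `E ≥ 0` throughout. A first critical radius, or a limit of `v` other than `0`,
would give a value in `(0, α]` with vanishing flux, where the energy is the negative number
`∫₀ᵛ k`; so `v` decreases strictly to `0` (`IsRadialProfile.tendsto_zero_of_energy_bound`). The
infimum of the first set is such a `ξ`: it is larger than `α`, as central values slightly above `α`
have negative energy from the start (`exists_decaying_profile`).

The first set is nonempty because a profile that remains above a value `ξ₁` of positive potential up
to a large radius `R₀` loses little energy afterwards, the dissipation being proportional to
`n / r`, and must cross zero (`exists_crossing_radius`). Such profiles exist: if `f > 0` on `(α, ∞)`,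
a start at height `ξ₁ + R₀ + 1` suffices since `|v'| < 1`; otherwise `β` is an equilibrium, and
profiles starting close to `β` stay close to it.

For the regularity of `u` at the origin, the flux field is `-A(|x|) x` with
`A(r) = ∫₀¹ τⁿ k(v(rτ)) dτ`. It is `C¹` because `r A'(r) = k(v) - (n + 1) A` tends to `0` at `0`, and
`∇u` is a smooth function of it.
-/

open Set Filter Topology

/-! ### Slopes, fluxes and radial profiles -/

/-- The slope `p / √(1 + p²)` of a profile whose flux is `p`: the inverse of
`q ↦ q / √(1 - q²)`. -/
noncomputable def slopeOfFlux (p : ℝ) : ℝ := p / √(1 + p ^ 2)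

lemma sqrt_one_add_sq_pos (p : ℝ) : 0 < √(1 + p ^ 2) := Real.sqrt_pos.2 (by positivity)

lemma abs_lt_sqrt_one_add_sq (p : ℝ) : |p| < √(1 + p ^ 2) := by
  rw [← Real.sqrt_sq_eq_abs]
  exact Real.sqrt_lt_sqrt (sq_nonneg p) (by linarith)

lemma hasDerivAt_sqrt_one_add_sq (p : ℝ) :
    HasDerivAt (fun p : ℝ => √(1 + p ^ 2)) (slopeOfFlux p) p := by
  have h := ((hasDerivAt_pow 2 p).const_add (1 : ℝ)).sqrt (by positivity)
  refine h.congr_deriv ?_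
  have := sqrt_one_add_sq_pos p
  simp only [slopeOfFlux]
  field_simp
  norm_num

lemma abs_slopeOfFlux_lt_one (p : ℝ) : |slopeOfFlux p| < 1 := by
  rw [slopeOfFlux, abs_div, abs_of_pos (sqrt_one_add_sq_pos p), div_lt_one (sqrt_one_add_sq_pos p)]
  exact abs_lt_sqrt_one_add_sq p

lemma hasDerivAt_slopeOfFlux (p : ℝ) :
    HasDerivAt slopeOfFlux (1 / √(1 + p ^ 2) ^ 3) p := by
  have h := (hasDerivAt_id p).div (hasDerivAt_sqrt_one_add_sq p) (sqrt_one_add_sq_pos p).ne'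
  refine h.congr_deriv ?_
  have h0 := sqrt_one_add_sq_pos p
  have h1 : √(1 + p ^ 2) ^ 2 = 1 + p ^ 2 := Real.sq_sqrt (by positivity)
  simp only [id, slopeOfFlux]
  field_simp
  linarith

lemma continuous_slopeOfFlux : Continuous slopeOfFlux :=
  continuous_iff_continuousAt.2 fun p => (hasDerivAt_slopeOfFlux p).continuousAt

lemma abs_slopeOfFlux_sub_le (a b : ℝ) : |slopeOfFlux a - slopeOfFlux b| ≤ |a - b| := by
  have h : LipschitzWith 1 slopeOfFlux := by
    refine lipschitzWith_of_nnnorm_deriv_le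
      (fun p => (hasDerivAt_slopeOfFlux p).differentiableAt) fun p => ?_
    rw [(hasDerivAt_slopeOfFlux p).deriv, ← NNReal.coe_le_coe, coe_nnnorm, Real.norm_eq_abs,
      abs_of_pos (by have := sqrt_one_add_sq_pos p; positivity), NNReal.coe_one]
    have h1 : 1 ≤ √(1 + p ^ 2) := Real.one_le_sqrt.2 (by nlinarith [sq_nonneg p])
    rw [div_le_one (by positivity)]
    exact one_le_pow₀ h1
  simpa [Real.dist_eq] using h.dist_le_mul a b

lemma slopeOfFlux_pos {p : ℝ} (hp : 0 < p) : 0 < slopeOfFlux p :=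
  div_pos hp (sqrt_one_add_sq_pos p)

lemma slopeOfFlux_eq_zero {p : ℝ} (hp : slopeOfFlux p = 0) : p = 0 := by
  rcases div_eq_zero_iff.1 hp with h | h
  · exact h
  · exact absurd h (sqrt_one_add_sq_pos p).ne'

/-- The weighted mean `∫₀¹ τⁿ k(v(rτ)) dτ`. For `r > 0` it equals `r⁻⁽ⁿ⁺¹⁾ ∫₀ʳ tⁿ k(v(t)) dt`, so
`r * weightedMean n k v r` is the flux of a radial solution at radius `r` in dimension `n + 1`.
Written over `[0, 1]` it has no singularity at `r = 0`. -/
noncomputable def weightedMean (n : ℕ) (k v : ℝ → ℝ) (r : ℝ) : ℝ :=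
  ∫ τ in (0 : ℝ)..1, τ ^ n * k (v (r * τ))

lemma continuous_weightedMean (n : ℕ) {k v : ℝ → ℝ} (hk : Continuous k) (hv : Continuous v) :
    Continuous (weightedMean n k v) := by
  unfold weightedMean
  apply intervalIntegral.continuous_parametric_intervalIntegral_of_continuous'
  fun_prop

/-- A radial profile with central value `ξ`: a solution on all of `ℝ` of the integrated radial
equation `v' = -p / √(1 + p²)`, `p(r) = r⁻ⁿ ∫₀ʳ tⁿ k(v(t)) dt`. -/
structure IsRadialProfile (n : ℕ) (k : ℝ → ℝ) (ξ : ℝ) (v : ℝ → ℝ) : Prop where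
  apply_zero : v 0 = ξ
  hasDerivAt : ∀ r, HasDerivAt v (-slopeOfFlux (r * weightedMean n k v r)) r

/-! ### Existence of profiles and dependence on the central value -/

lemma abs_integral_le_of_abs_le_exp {d : ℝ → ℝ} {A l : ℝ} (hA : 0 ≤ A) (hl : 0 < l)
    (h : ∀ t, |d t| ≤ A * Real.exp (l * |t|)) (r : ℝ) :
    |∫ t in (0 : ℝ)..r, d t| ≤ A / l * Real.exp (l * |r|) := by
  have key : ∀ (d : ℝ → ℝ), (∀ t, |d t| ≤ A * Real.exp (l * |t|)) → ∀ r, 0 ≤ r →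
      |∫ t in (0 : ℝ)..r, d t| ≤ A / l * Real.exp (l * |r|) := by
    intro d h r hr
    have h1 : ‖∫ t in (0 : ℝ)..r, d t‖ ≤ ∫ t in (0 : ℝ)..r, A * Real.exp (l * t) := by
      refine intervalIntegral.norm_integral_le_of_norm_le hr ?_ ?_
      · refine Filter.Eventually.of_forall fun t ht => ?_
        have := h t
        rwa [abs_of_pos ht.1] at this
      · exact (by fun_prop : Continuous fun t => A * Real.exp (l * t)).intervalIntegrable _ _
    have h2 : ∫ t in (0 : ℝ)..r, A * Real.exp (l * t) =
        A / l * Real.exp (l * r) - A / l * Real.exp (l * 0) := by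
      refine intervalIntegral.integral_eq_sub_of_hasDerivAt
        (f := fun t => A / l * Real.exp (l * t)) (fun t _ => ?_)
        ((by fun_prop : Continuous fun t => A * Real.exp (l * t)).intervalIntegrable _ _)
      have := (((hasDerivAt_id t).const_mul l).exp).const_mul (A / l)
      refine this.congr_deriv ?_
      simp only [id]
      field_simp
    rw [h2] at h1
    rw [abs_of_nonneg hr]
    have : 0 ≤ A / l * Real.exp (l * 0) := by positivity
    rw [Real.norm_eq_abs] at h1
    linarith
  rcases le_total 0 r with hr | hr
  · exact key d h r hr
  · have h3 := key (fun t => d (-t)) (fun t => by simpa using h (-t)) (-r) (by linarith)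
    rw [intervalIntegral.integral_comp_neg, neg_neg, neg_zero, intervalIntegral.integral_symm,
      abs_neg, abs_neg] at h3
    exact h3

lemma abs_mul_weightedMean_sub_le (n : ℕ) {k v w : ℝ → ℝ} {L : NNReal} (hk : LipschitzWith L k)
    (hv : Continuous v) (hw : Continuous w) {A l : ℝ} (hA : 0 ≤ A) (hl : 0 < l)
    (h : ∀ t, |v t - w t| ≤ A * Real.exp (l * |t|)) (r : ℝ) :
    |r * weightedMean n k v r - r * weightedMean n k w r|
      ≤ L * A / l * Real.exp (l * |r|) := by
  have hkc := hk.continuous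
  have h1 : weightedMean n k v r - weightedMean n k w r =
      ∫ τ in (0 : ℝ)..1, τ ^ n * (k (v (r * τ)) - k (w (r * τ))) := by
    unfold weightedMean
    rw [← intervalIntegral.integral_sub]
    · simp only [mul_sub]
    · exact (by fun_prop : Continuous fun τ => τ ^ n * k (v (r * τ))).intervalIntegrable _ _
    · exact (by fun_prop : Continuous fun τ => τ ^ n * k (w (r * τ))).intervalIntegrable _ _
  have h2 : |weightedMean n k v r - weightedMean n k w r| ≤
      ∫ τ in (0 : ℝ)..1, |k (v (r * τ)) - k (w (r * τ))| := by
    rw [h1, ← Real.norm_eq_abs]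
    refine intervalIntegral.norm_integral_le_of_norm_le zero_le_one
      (Filter.Eventually.of_forall fun τ hτ => ?_) ?_
    · rw [Real.norm_eq_abs, abs_mul, abs_of_nonneg (pow_nonneg hτ.1.le n)]
      exact mul_le_of_le_one_left (abs_nonneg _) (pow_le_one₀ hτ.1.le hτ.2)
    · exact (by fun_prop : Continuous
        fun τ => |k (v (r * τ)) - k (w (r * τ))|).intervalIntegrable _ _
  have h0 : 0 ≤ ∫ τ in (0 : ℝ)..1, |k (v (r * τ)) - k (w (r * τ))| :=
    intervalIntegral.integral_nonneg zero_le_one fun τ _ => abs_nonneg _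
  have h3 := intervalIntegral.mul_integral_comp_mul_left (a := 0) (b := 1)
    (f := fun t => |k (v t) - k (w t)|) r
  rw [mul_zero, mul_one] at h3
  rw [← mul_sub, abs_mul]
  calc |r| * |weightedMean n k v r - weightedMean n k w r|
      ≤ |r| * ∫ τ in (0 : ℝ)..1, |k (v (r * τ)) - k (w (r * τ))| := by gcongr
    _ = |∫ t in (0 : ℝ)..r, (|k (v t) - k (w t)|)| := by
        rw [← h3, abs_mul, abs_of_nonneg h0]
    _ ≤ L * A / l * Real.exp (l * |r|) := by
        refine abs_integral_le_of_abs_le_exp (by positivity) hl (fun t => ?_) r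
        rw [abs_abs, mul_assoc]
        have := hk.dist_le_mul (v t) (w t)
        rw [Real.dist_eq, Real.dist_eq] at this
        exact this.trans (by gcongr; exact h t)

/-- The profile encoded by the bounded function `h`: exponentially weighted deviation from `ξ`. -/
noncomputable def weightedProfile (l ξ : ℝ) (h : BoundedContinuousFunction ℝ ℝ) (r : ℝ) : ℝ :=
  ξ + Real.exp (l * |r|) * h r

lemma continuous_weightedProfile (l ξ : ℝ) (h : BoundedContinuousFunction ℝ ℝ) :
    Continuous (weightedProfile l ξ h) := by
  unfold weightedProfile
  have := h.continuous
  fun_prop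

lemma continuous_slope_weightedProfile (n : ℕ) {k : ℝ → ℝ} (hk : Continuous k) (l ξ : ℝ)
    (h : BoundedContinuousFunction ℝ ℝ) :
    Continuous fun s => slopeOfFlux (s * weightedMean n k (weightedProfile l ξ h) s) :=
  continuous_slopeOfFlux.comp
    (continuous_id.mul (continuous_weightedMean n hk (continuous_weightedProfile l ξ h)))

/-- The Picard operator of the radial equation, in the exponentially weighted unknown. It maps
into bounded functions for `l > 0` because slopes are bounded by `1`. -/
noncomputable def picardMap (n : ℕ) {k : ℝ → ℝ} (hk : Continuous k) {l : ℝ} (hl : 0 < l) (ξ : ℝ)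
    (h : BoundedContinuousFunction ℝ ℝ) : BoundedContinuousFunction ℝ ℝ :=
  BoundedContinuousFunction.ofNormedAddCommGroup
    (fun r => Real.exp (-(l * |r|)) *
      -∫ s in (0 : ℝ)..r, slopeOfFlux (s * weightedMean n k (weightedProfile l ξ h) s))
    (by
      have := intervalIntegral.continuous_primitive (μ := MeasureTheory.volume)
        (fun a b => (continuous_slope_weightedProfile n hk l ξ h).intervalIntegrable a b) 0
      fun_prop)
    (1 / l)
    (fun r => by
      have h1 : ‖∫ s in (0 : ℝ)..r,
          slopeOfFlux (s * weightedMean n k (weightedProfile l ξ h) s)‖ ≤ 1 * |r - 0| :=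
        intervalIntegral.norm_integral_le_of_norm_le_const fun s _ =>
          (abs_slopeOfFlux_lt_one _).le
      rw [norm_mul, norm_neg, Real.norm_eq_abs, Real.abs_exp, Real.exp_neg]
      rw [sub_zero, one_mul] at h1
      have h2 : l * |r| ≤ Real.exp (l * |r|) := by linarith [Real.add_one_le_exp (l * |r|)]
      have h3 := Real.exp_pos (l * |r|)
      calc (Real.exp (l * |r|))⁻¹ * _ ≤ (Real.exp (l * |r|))⁻¹ * |r| := by gcongr
        _ ≤ 1 / l := by
          rw [inv_mul_le_iff₀ h3, mul_one_div, le_div_iff₀ hl]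
          linarith)

lemma dist_picardMap_le (n : ℕ) {k : ℝ → ℝ} {L : NNReal} (hk : LipschitzWith L k) {l : ℝ}
    (hl : 0 < l) (ξ η : ℝ) (h h' : BoundedContinuousFunction ℝ ℝ) :
    dist (picardMap n hk.continuous hl ξ h) (picardMap n hk.continuous hl η h') ≤
      L / l ^ 2 * (|ξ - η| + dist h h') := by
  have hD : 0 ≤ |ξ - η| + dist h h' := by positivity
  rw [BoundedContinuousFunction.dist_le (by positivity)]
  intro r
  have h1 : ∀ t, |weightedProfile l ξ h t - weightedProfile l η h' t| ≤
      (|ξ - η| + dist h h') * Real.exp (l * |t|) := by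
    intro t
    have e1 : 1 ≤ Real.exp (l * |t|) := Real.one_le_exp (by positivity)
    have e2 : |h t - h' t| ≤ dist h h' := by
      rw [← Real.dist_eq]; exact BoundedContinuousFunction.dist_coe_le_dist t
    have e3 : weightedProfile l ξ h t - weightedProfile l η h' t =
        (ξ - η) + Real.exp (l * |t|) * (h t - h' t) := by
      unfold weightedProfile; ring
    rw [e3]
    calc |(ξ - η) + Real.exp (l * |t|) * (h t - h' t)|
        ≤ |ξ - η| + |Real.exp (l * |t|) * (h t - h' t)| := abs_add_le _ _
      _ = |ξ - η| * 1 + Real.exp (l * |t|) * |h t - h' t| := by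
          rw [abs_mul, Real.abs_exp, mul_one]
      _ ≤ |ξ - η| * Real.exp (l * |t|) + Real.exp (l * |t|) * dist h h' := by gcongr
      _ = _ := by ring
  have h2 := abs_mul_weightedMean_sub_le n hk (continuous_weightedProfile l ξ h)
    (continuous_weightedProfile l η h') hD hl h1
  have h3 := abs_integral_le_of_abs_le_exp (by positivity) hl
    (fun t => (abs_slopeOfFlux_sub_le _ _).trans (h2 t)) r
  rw [intervalIntegral.integral_sub
    ((continuous_slope_weightedProfile n hk.continuous l ξ h).intervalIntegrable _ _)
    ((continuous_slope_weightedProfile n hk.continuous l η h').intervalIntegrable _ _)] at h3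
  simp only [picardMap, BoundedContinuousFunction.coe_ofNormedAddCommGroup]
  rw [Real.dist_eq, ← mul_sub, abs_mul, Real.abs_exp, Real.exp_neg,
    inv_mul_le_iff₀ (Real.exp_pos _), neg_sub_neg, abs_sub_comm]
  refine h3.trans (le_of_eq ?_)
  field_simp

/-- A globally Lipschitz nonlinearity has a profile for every central value; profiles depend
Lipschitz-continuously on the central value over bounded intervals; and the profile starting at a
zero of `k` is constant. -/
theorem exists_radialProfile (n : ℕ) {k : ℝ → ℝ} {L : NNReal} (hk : LipschitzWith L k) :
    ∃ (v : ℝ → ℝ → ℝ) (l : ℝ), 0 < l ∧ (∀ ξ, IsRadialProfile n k ξ (v ξ)) ∧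
      (∀ ξ η r, |v ξ r - v η r| ≤ 2 * |ξ - η| * Real.exp (l * |r|)) ∧
      (∀ ξ, k ξ = 0 → ∀ r, v ξ r = ξ) := by
  obtain ⟨l, hl, hL⟩ : ∃ l : ℝ, 0 < l ∧ L / l ^ 2 ≤ 1 / 2 := by
    refine ⟨2 * L + 1, by positivity, ?_⟩
    have : (0 : ℝ) ≤ L := L.2
    rw [div_le_div_iff₀ (by positivity) (by norm_num)]
    nlinarith
  have hT : ∀ ξ, ContractingWith (1 / 2) (picardMap n hk.continuous hl ξ) := by
    intro ξ
    refine ⟨by rw [← NNReal.coe_lt_coe]; norm_num, LipschitzWith.of_dist_le_mul fun h h' => ?_⟩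
    have := dist_picardMap_le n hk hl ξ ξ h h'
    rw [sub_self, abs_zero, zero_add] at this
    refine this.trans ?_
    have e : ((1 / 2 : NNReal) : ℝ) = 1 / 2 := by norm_num
    rw [e]
    gcongr
  set H : ℝ → BoundedContinuousFunction ℝ ℝ := fun ξ => (hT ξ).fixedPoint with hH
  have hfix : ∀ ξ, picardMap n hk.continuous hl ξ (H ξ) = H ξ := fun ξ =>
    (hT ξ).fixedPoint_isFixedPt
  have heq : ∀ ξ r, weightedProfile l ξ (H ξ) r = ξ -
      ∫ s in (0 : ℝ)..r, slopeOfFlux (s * weightedMean n k (weightedProfile l ξ (H ξ)) s) := by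
    intro ξ r
    have h1 : H ξ r = _ := congrArg (fun h : BoundedContinuousFunction ℝ ℝ => h r) (hfix ξ).symm
    simp only [picardMap, BoundedContinuousFunction.coe_ofNormedAddCommGroup] at h1
    conv_lhs => rw [weightedProfile, h1]
    rw [← mul_assoc, ← Real.exp_add, add_neg_cancel, Real.exp_zero, one_mul, sub_eq_add_neg]
  refine ⟨fun ξ => weightedProfile l ξ (H ξ), l, hl, fun ξ => ⟨?_, fun r => ?_⟩, ?_, ?_⟩
  · exact (heq ξ 0).trans (by simp)
  · have h1 := (intervalIntegral.integral_hasDerivAt_right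
      ((continuous_slope_weightedProfile n hk.continuous l ξ (H ξ)).intervalIntegrable 0 r)
      ((continuous_slope_weightedProfile n hk.continuous l ξ
        (H ξ)).stronglyMeasurableAtFilter _ _)
      (continuous_slope_weightedProfile n hk.continuous l ξ (H ξ)).continuousAt).const_sub ξ
    exact h1.congr_of_eventuallyEq (Filter.Eventually.of_forall fun s => heq ξ s)
  · intro ξ η r
    have h1 := dist_picardMap_le n hk hl ξ η (H ξ) (H η)
    rw [hfix, hfix] at h1
    have hd : dist (H ξ) (H η) ≤ |ξ - η| := by
      have : L / l ^ 2 * (|ξ - η| + dist (H ξ) (H η)) ≤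
          1 / 2 * (|ξ - η| + dist (H ξ) (H η)) := by gcongr
      linarith
    have e1 : 1 ≤ Real.exp (l * |r|) := Real.one_le_exp (by positivity)
    have e2 : |H ξ r - H η r| ≤ |ξ - η| := by
      rw [← Real.dist_eq]; exact (BoundedContinuousFunction.dist_coe_le_dist r).trans hd
    have e3 : weightedProfile l ξ (H ξ) r - weightedProfile l η (H η) r =
        (ξ - η) + Real.exp (l * |r|) * (H ξ r - H η r) := by
      unfold weightedProfile; ring
    change |weightedProfile l ξ (H ξ) r - weightedProfile l η (H η) r| ≤ _
    rw [e3]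
    calc |(ξ - η) + Real.exp (l * |r|) * (H ξ r - H η r)|
        ≤ |ξ - η| * 1 + Real.exp (l * |r|) * |H ξ r - H η r| := by
          refine (abs_add_le _ _).trans (le_of_eq ?_)
          rw [abs_mul, Real.abs_exp, mul_one]
      _ ≤ |ξ - η| * Real.exp (l * |r|) + Real.exp (l * |r|) * |ξ - η| := by gcongr
      _ = _ := by ring
  · intro ξ hξ r
    have h0 : picardMap n hk.continuous hl ξ 0 = 0 := by
      ext r
      simp [picardMap, weightedProfile, weightedMean, hξ, slopeOfFlux]
    have h1 : H ξ = 0 := ((hT ξ).fixedPoint_unique h0).symm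
    simp [weightedProfile, h1]

/-! ### Calculus lemmas -/

lemma hasDerivAt_primitiveF {k : ℝ → ℝ} (hk : Continuous k) (s : ℝ) :
    HasDerivAt (primitiveF k) (k s) s :=
  intervalIntegral.integral_hasDerivAt_right (hk.intervalIntegrable _ _)
    (hk.stronglyMeasurableAtFilter _ _) hk.continuousAt

lemma continuous_primitiveF {k : ℝ → ℝ} (hk : Continuous k) : Continuous (primitiveF k) :=
  continuous_iff_continuousAt.2 fun s => (hasDerivAt_primitiveF hk s).continuousAt

lemma primitiveF_zero (k : ℝ → ℝ) : primitiveF k 0 = 0 := intervalIntegral.integral_same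

lemma primitiveF_neg_of_neg {k : ℝ → ℝ} (hk : Continuous k) {a s : ℝ}
    (hneg : ∀ t ∈ Ioo 0 a, k t < 0) (hs : s ∈ Ioc 0 a) : primitiveF k s < 0 := by
  have h := intervalIntegral.intervalIntegral_pos_of_pos_on (f := fun t => -k t)
    (hk.neg.intervalIntegrable 0 s) (fun t ht => by
      have := hneg t ⟨ht.1, ht.2.trans_le hs.2⟩
      linarith) hs.1
  rw [intervalIntegral.integral_neg] at h
  unfold primitiveF
  linarith

lemma primitiveF_eq_zero_of_nonpos {k : ℝ → ℝ} (h0 : ∀ s ≤ 0, k s = 0) {s : ℝ} (hs : s ≤ 0) :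
    primitiveF k s = 0 := by
  unfold primitiveF
  rw [intervalIntegral.integral_symm, neg_eq_zero]
  refine intervalIntegral.integral_zero_ae (Filter.Eventually.of_forall fun t ht => ?_)
  rw [uIoc_of_le hs] at ht
  exact h0 t ht.2

/-- If a function and its derivative both converge at infinity, the derivative tends to `0`. -/
lemma limit_deriv_eq_zero {h h' : ℝ → ℝ} {l d : ℝ} (hd : ∀ r > 0, HasDerivAt h (h' r) r)
    (hl : Tendsto h atTop (𝓝 l)) (hl' : Tendsto h' atTop (𝓝 d)) : d = 0 := by
  have hc : ∀ r : ℝ, ∃ c, r ≤ c ∧ (0 < r → h' c = h (r + 1) - h r) := by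
    intro r
    by_cases hr : 0 < r
    · obtain ⟨c, hc, hc'⟩ := exists_hasDerivAt_eq_slope h h' (lt_add_one r)
        (fun x hx => (hd x (hr.trans_le hx.1)).continuousAt.continuousWithinAt)
        (fun x hx => hd x (hr.trans hx.1))
      exact ⟨c, hc.1.le, fun _ => by rw [hc']; simp⟩
    · exact ⟨r, le_rfl, fun h => absurd h hr⟩
  choose c hc1 hc2 using hc
  have h1 : Tendsto (fun r => h' (c r)) atTop (𝓝 d) :=
    hl'.comp (tendsto_atTop_mono hc1 tendsto_id)
  have h2 : Tendsto (fun r => h (r + 1) - h r) atTop (𝓝 (l - l)) :=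
    (hl.comp (tendsto_atTop_add_const_right _ 1 tendsto_id)).sub hl
  rw [sub_self] at h2
  refine tendsto_nhds_unique h1 (h2.congr' ?_)
  filter_upwards [eventually_gt_atTop 0] with r hr using (hc2 r hr).symm

lemma exists_first_zero {p : ℝ → ℝ} (hp : Continuous p) {δ r : ℝ}
    (hδ0 : 0 < δ) (hpos : ∀ s ∈ Ioc 0 δ, 0 < p s) (hr : 0 < r) (hpr : p r ≤ 0) :
    ∃ R, 0 < R ∧ p R = 0 ∧ ∀ s ∈ Ioo 0 R, 0 < p s := by
  have hδ : ∀ s, 0 < s → p s ≤ 0 → δ < s := fun s hs h => by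
    by_contra! h'
    exact absurd (hpos s ⟨hs, h'⟩) (not_lt.2 h)
  obtain ⟨R, ⟨⟨hR1, hR2⟩, hR3⟩, hmin⟩ :=
    (isCompact_Icc.inter_right (isClosed_le hp continuous_const)).exists_isLeast
      (⟨r, ⟨(hδ r hr hpr).le, le_rfl⟩, hpr⟩ : (Icc δ r ∩ {s | p s ≤ 0}).Nonempty)
  have hR0 : 0 < R := hδ0.trans_le hR1
  have hbefore : ∀ s ∈ Ioo 0 R, 0 < p s := by
    intro s hs
    by_contra! h
    exact absurd (hmin ⟨⟨(hδ s hs.1 h).le, hs.2.le.trans hR2⟩, h⟩) (not_le.2 hs.2)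
  refine ⟨R, hR0, le_antisymm hR3 ?_, hbefore⟩
  refine ge_of_tendsto (hp.continuousAt.tendsto.mono_left (nhdsWithin_le_nhds (s := Iio R))) ?_
  filter_upwards [Ioo_mem_nhdsLT hR0] with s hs using (hbefore s hs).le

lemma deriv_nonpos_of_first_zero {p : ℝ → ℝ} {p' R : ℝ} (hR : 0 < R) (hd : HasDerivAt p p' R)
    (h0 : p R = 0) (hpos : ∀ s ∈ Ioo 0 R, 0 < p s) : p' ≤ 0 := by
  have h1 : Tendsto (slope p R) (𝓝[<] R) (𝓝 p') :=
    (hasDerivAt_iff_tendsto_slope.1 hd).mono_left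
      (nhdsWithin_mono _ fun s (hs : s < R) => hs.ne)
  refine le_of_tendsto h1 ?_
  filter_upwards [Ioo_mem_nhdsLT hR] with s hs
  rw [slope_def_field, h0, sub_zero]
  exact div_nonpos_of_nonneg_of_nonpos (hpos s hs).le (by linarith [hs.2])

/-! ### Flux and energy of a profile -/

/-- The flux `v' / √(1 - v'²)` of a radial profile, with the sign reversed. -/
noncomputable def flux (n : ℕ) (k v : ℝ → ℝ) (r : ℝ) : ℝ := r * weightedMean n k v r

/-- The energy `1 / √(1 - v'²) - 1 + ∫₀ᵛ k` of a radial profile, expressed through the flux. -/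
noncomputable def energy (n : ℕ) (k v : ℝ → ℝ) (r : ℝ) : ℝ :=
  √(1 + flux n k v r ^ 2) - 1 + primitiveF k (v r)

lemma primitiveF_le_energy (n : ℕ) (k v : ℝ → ℝ) (r : ℝ) :
    primitiveF k (v r) ≤ energy n k v r := by
  have : 1 ≤ √(1 + flux n k v r ^ 2) := Real.one_le_sqrt.2 (by nlinarith [sq_nonneg (flux n k v r)])
  unfold energy
  linarith

lemma energy_of_flux_eq_zero {n : ℕ} {k v : ℝ → ℝ} {r : ℝ} (h : flux n k v r = 0) :
    energy n k v r = primitiveF k (v r) := by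
  simp [energy, h]

namespace IsRadialProfile

variable {n : ℕ} {k v : ℝ → ℝ} {ξ : ℝ}

lemma hasDerivAt_flux_form (hv : IsRadialProfile n k ξ v) (r : ℝ) :
    HasDerivAt v (-slopeOfFlux (flux n k v r)) r := hv.hasDerivAt r

lemma continuous (hv : IsRadialProfile n k ξ v) : Continuous v :=
  continuous_iff_continuousAt.2 fun r => (hv.hasDerivAt r).continuousAt

lemma continuous_flux (hv : IsRadialProfile n k ξ v) (hk : Continuous k) :
    Continuous (flux n k v) :=
  continuous_id.mul (continuous_weightedMean n hk hv.continuous)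

lemma continuous_energy (hv : IsRadialProfile n k ξ v) (hk : Continuous k) :
    Continuous (energy n k v) := by
  have h1 := hv.continuous_flux hk
  have h2 := (continuous_primitiveF hk).comp hv.continuous
  unfold energy
  exact ((continuous_const.add (h1.pow 2)).sqrt.sub continuous_const).add h2

lemma sub_le_apply (hv : IsRadialProfile n k ξ v) {r : ℝ} (hr : 0 ≤ r) : ξ - r ≤ v r := by
  have h : Monotone fun s => v s + s := by
    refine monotone_of_hasDerivAt_nonneg
      (fun s => (hv.hasDerivAt s).add (hasDerivAt_id s)) fun s => ?_
    have := (abs_lt.1 (abs_slopeOfFlux_lt_one (s * weightedMean n k v s))).2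
    simp only [Pi.zero_apply]
    linarith
  have := h hr
  simp only [hv.apply_zero] at this
  linarith

lemma pow_mul_flux (n : ℕ) (k v : ℝ → ℝ) (r : ℝ) :
    r ^ n * flux n k v r = ∫ t in (0 : ℝ)..r, t ^ n * k (v t) := by
  have h := intervalIntegral.mul_integral_comp_mul_left (a := 0) (b := 1)
    (f := fun t => t ^ n * k (v t)) r
  rw [mul_zero, mul_one] at h
  rw [← h, flux, weightedMean, mul_left_comm, ← intervalIntegral.integral_const_mul]
  simp only [mul_pow, mul_assoc]

lemma hasDerivAt_flux (hv : IsRadialProfile n k ξ v) (hk : Continuous k) {r : ℝ} (hr : 0 < r) :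
    HasDerivAt (flux n k v) (k (v r) - n / r * flux n k v r) r := by
  have hc : Continuous fun t => t ^ n * k (v t) := by
    have := hv.continuous
    fun_prop
  have h1 : HasDerivAt (fun s => ∫ t in (0 : ℝ)..s, t ^ n * k (v t)) (r ^ n * k (v r)) r :=
    intervalIntegral.integral_hasDerivAt_right (hc.intervalIntegrable _ _)
      (hc.stronglyMeasurableAtFilter _ _) hc.continuousAt
  have hrn : r ^ n ≠ 0 := (pow_pos hr n).ne'
  have h2 := (h1.div (hasDerivAt_pow n r) hrn).congr_of_eventuallyEq
    (f₁ := flux n k v) (by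
      filter_upwards [lt_mem_nhds hr] with s hs
      rw [Pi.div_apply, ← pow_mul_flux, mul_div_cancel_left₀ _ (pow_pos hs n).ne'])
  refine h2.congr_deriv ?_
  rw [← pow_mul_flux]
  rcases n with _ | m
  · simp
  · rw [Nat.add_sub_cancel]
    field_simp
    ring

lemma hasDerivAt_energy (hv : IsRadialProfile n k ξ v) (hk : Continuous k) {r : ℝ} (hr : 0 < r) :
    HasDerivAt (energy n k v) (-(n / r * (flux n k v r * slopeOfFlux (flux n k v r)))) r := by
  have h1 := (hasDerivAt_sqrt_one_add_sq (flux n k v r)).comp r (hv.hasDerivAt_flux hk hr)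
  have h2 := (hasDerivAt_primitiveF hk (v r)).comp r (hv.hasDerivAt_flux_form r)
  refine ((h1.sub_const 1).add h2).congr_deriv ?_
  ring

lemma flux_mul_slope_nonneg (p : ℝ) : 0 ≤ p * slopeOfFlux p := by
  rw [slopeOfFlux, ← mul_div_assoc]
  exact div_nonneg (mul_self_nonneg p) (Real.sqrt_nonneg _)

/-- The energy is dissipated: `E' = -(n / r) p p / √(1 + p²) ≤ 0`. -/
lemma antitoneOn_energy (hv : IsRadialProfile n k ξ v) (hk : Continuous k) :
    AntitoneOn (energy n k v) (Ici 0) := by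
  refine antitoneOn_of_hasDerivWithinAt_nonpos (convex_Ici 0) (hv.continuous_energy hk).continuousOn
    (fun r hr => (hv.hasDerivAt_energy hk (by simpa using hr)).hasDerivWithinAt) fun r hr => ?_
  rw [interior_Ici] at hr
  have := flux_mul_slope_nonneg (flux n k v r)
  have hr' : 0 < r := hr
  rw [Left.neg_nonpos_iff]
  positivity

lemma strictAntiOn_of_flux_pos (hv : IsRadialProfile n k ξ v) {s : Set ℝ} (hs : Convex ℝ s)
    (h : ∀ r ∈ interior s, 0 < flux n k v r) : StrictAntiOn v s := by
  refine strictAntiOn_of_hasDerivWithinAt_neg hs hv.continuous.continuousOn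
    (fun r _ => (hv.hasDerivAt_flux_form r).hasDerivWithinAt) fun r hr => ?_
  exact neg_neg_of_pos (slopeOfFlux_pos (h r hr))

/-- Near the centre the flux is positive as long as the profile stays where `k > 0`. -/
lemma exists_flux_pos_near_zero (hv : IsRadialProfile n k ξ v) (hk : Continuous k)
    (hξ : 0 < k ξ) : ∃ δ > 0, ∀ r ∈ Ioc 0 δ, 0 < flux n k v r := by
  have h1 : ∀ᶠ r in 𝓝 (0 : ℝ), 0 < k (v r) :=
    (hk.comp hv.continuous).continuousAt.eventually_const_lt (by simpa [hv.apply_zero] using hξ)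
  obtain ⟨ε, hε, h2⟩ := Metric.eventually_nhds_iff.1 h1
  refine ⟨ε / 2, by positivity, fun r hr => mul_pos hr.1 ?_⟩
  refine intervalIntegral.intervalIntegral_pos_of_pos_on ?_ (fun τ hτ => ?_) zero_lt_one
  · have := hv.continuous
    exact (by fun_prop : Continuous fun τ => τ ^ n * k (v (r * τ))).intervalIntegrable _ _
  · refine mul_pos (pow_pos hτ.1 n) (h2 ?_)
    rw [Real.dist_eq, sub_zero, abs_of_pos (mul_pos hr.1 hτ.1)]
    have := hτ.1
    have := hτ.2
    nlinarith [hr.1, hr.2]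

/-- A nonnegative profile cannot touch `0`: it would do so with zero flux, and by the uniqueness
theorem for the equation away from the centre it would vanish identically. -/
lemma pos_of_nonneg (hv : IsRadialProfile n k ξ v) {L : NNReal} (hk : LipschitzWith L k)
    (hk0 : k 0 = 0) (hξ : 0 < ξ) (hnn : ∀ r, 0 ≤ r → 0 ≤ v r) {r : ℝ} (hr : 0 ≤ r) : 0 < v r := by
  by_contra! hvr
  have hvr0 : v r = 0 := le_antisymm hvr (hnn r hr)
  have hrξ : ξ ≤ r := by linarith [hv.sub_le_apply hr]
  have hr0 : 0 < r := hξ.trans_le hrξ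
  have hmin : IsLocalMin v r := by
    filter_upwards [lt_mem_nhds hr0] with s hs
    rw [hvr0]
    exact hnn s hs.le
  have hp0 : flux n k v r = 0 :=
    slopeOfFlux_eq_zero (neg_eq_zero.1 (hmin.hasDerivAt_eq_zero (hv.hasDerivAt_flux_form r)))
  set δ := ξ / 2 with hδ
  have hδ0 : 0 < δ := by positivity
  set K : ℝ := 1 + L + 2 * (n / δ) with hK
  set p := flux n k v with hp
  have hmono : MonotoneOn (fun s => (v s ^ 2 + p s ^ 2) * Real.exp (K * s)) (Icc δ r) := by
    have hd : ∀ s ∈ interior (Icc δ r), HasDerivAt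
        (fun s => (v s ^ 2 + p s ^ 2) * Real.exp (K * s)) _ s := fun s hs => by
      rw [interior_Icc] at hs
      exact (((hv.hasDerivAt_flux_form s).pow 2).add
        ((hv.hasDerivAt_flux hk.continuous (hδ0.trans hs.1)).pow 2)).mul
        ((hasDerivAt_id s).const_mul K).exp
    refine monotoneOn_of_hasDerivWithinAt_nonneg (convex_Icc δ r) ?_
      (fun s hs => (hd s hs).hasDerivWithinAt) fun s hs => ?_
    · have h1 := hv.continuous
      have h2 : Continuous p := hv.continuous_flux hk.continuous
      exact (by fun_prop : Continuous
        fun s => (v s ^ 2 + p s ^ 2) * Real.exp (K * s)).continuousOn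
    · rw [interior_Icc] at hs
      have hg : |slopeOfFlux (p s)| ≤ |p s| := by
        simpa [slopeOfFlux] using abs_slopeOfFlux_sub_le (p s) 0
      have hkv : |k (v s)| ≤ L * |v s| := by
        simpa [Real.dist_eq, hk0] using hk.dist_le_mul (v s) 0
      have hn : (n : ℝ) / s * p s ^ 2 ≤ n / δ * p s ^ 2 := by
        gcongr
        exact hs.1.le
      have e1 : v s * slopeOfFlux (p s) ≤ |v s| * |p s| := by
        refine (le_abs_self _).trans ?_
        rw [abs_mul]
        gcongr
      have e2 : -(L * (|v s| * |p s|)) ≤ p s * k (v s) := by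
        have : |p s * k (v s)| ≤ |p s| * (L * |v s|) := by rw [abs_mul]; gcongr
        linarith [neg_abs_le (p s * k (v s))]
      have e3 : 2 * (|v s| * |p s|) ≤ v s ^ 2 + p s ^ 2 := by
        rw [← sq_abs (v s), ← sq_abs (p s)]
        nlinarith [sq_nonneg (|v s| - |p s|)]
      have e4 : (L : ℝ) * (2 * (|v s| * |p s|)) ≤ L * (v s ^ 2 + p s ^ 2) := by gcongr
      have e5 : 0 ≤ (n : ℝ) / δ * v s ^ 2 := by positivity
      have e6 : 0 ≤ 2 * (v s * -slopeOfFlux (p s)) + 2 * (p s * (k (v s) - n / s * p s)) +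
          K * (v s ^ 2 + p s ^ 2) := by
        rw [hK]
        nlinarith
      have := mul_nonneg (Real.exp_pos (K * s)).le e6
      simp only [id, Nat.cast_ofNat, Pi.add_apply, Pi.pow_apply]
      refine this.trans (le_of_eq ?_)
      ring
  have h1 := hmono (left_mem_Icc.2 (by linarith)) (right_mem_Icc.2 (by linarith))
    (by linarith : δ ≤ r)
  simp only [hvr0, hp0] at h1
  have h2 : 0 < v δ := by linarith [hv.sub_le_apply hδ0.le]
  have h3 : 0 < (v δ ^ 2 + p δ ^ 2) * Real.exp (K * δ) := by positivity
  norm_num at h1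
  linarith

/-- A profile with positive flux that stays nonnegative converges; its flux tends to `0`, so
its limit is a zero of `k` and carries all the remaining energy. -/
lemma exists_limit (hv : IsRadialProfile n k ξ v) (hk : Continuous k)
    (hnn : ∀ r, 0 ≤ r → 0 ≤ v r) (hp : ∀ r, 0 < r → 0 < flux n k v r) {e : ℝ}
    (he : ∀ r, 0 < r → e ≤ energy n k v r) :
    ∃ l, 0 ≤ l ∧ l < ξ ∧ Tendsto v atTop (𝓝 l) ∧ k l = 0 ∧ e ≤ primitiveF k l := by
  have hanti : StrictAntiOn v (Ici 0) :=
    hv.strictAntiOn_of_flux_pos (convex_Ici 0) fun r hr => hp r (by simpa using hr)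
  have lim : ∀ (h : ℝ → ℝ) (b : ℝ), AntitoneOn h (Ici 0) → (∀ r, 0 < r → b ≤ h r) →
      ∃ l, b ≤ l ∧ Tendsto h atTop (𝓝 l) := by
    intro h b hh hb
    have hmono : Antitone fun r => h (max r 1) := fun r s hrs =>
      hh (mem_Ici.2 (by positivity)) (mem_Ici.2 (by positivity)) (max_le_max_right 1 hrs)
    have hbdd : BddBelow (range fun r => h (max r 1)) :=
      ⟨b, by rintro _ ⟨r, rfl⟩; exact hb _ (by positivity)⟩
    refine ⟨⨅ r, h (max r 1), le_ciInf fun r => hb _ (by positivity),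
      (tendsto_atTop_ciInf hmono hbdd).congr' ?_⟩
    filter_upwards [eventually_ge_atTop 1] with r hr
    rw [max_eq_left hr]
  obtain ⟨l, hl0, hl⟩ := lim v 0 hanti.antitoneOn fun r hr => hnn r hr.le
  obtain ⟨E, hE0, hE⟩ := lim (energy n k v) e (hv.antitoneOn_energy hk) he
  have hΦ : Tendsto (fun r => primitiveF k (v r)) atTop (𝓝 (primitiveF k l)) :=
    (continuous_primitiveF hk).continuousAt.tendsto.comp hl
  have hflux : Tendsto (flux n k v) atTop (𝓝 √((E + 1 - primitiveF k l) ^ 2 - 1)) := by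
    have h1 := ((((hE.add_const 1).sub hΦ).pow 2).sub_const 1).sqrt
    refine h1.congr' ?_
    filter_upwards [eventually_gt_atTop 0] with r hr
    have : energy n k v r + 1 - primitiveF k (v r) = √(1 + flux n k v r ^ 2) := by
      unfold energy; ring
    rw [this, Real.sq_sqrt (by positivity), add_sub_cancel_left, Real.sqrt_sq (hp r hr).le]
  set q := √((E + 1 - primitiveF k l) ^ 2 - 1) with hq
  have hq0 : q = 0 := by
    have h1 : Tendsto (fun r => -slopeOfFlux (flux n k v r)) atTop (𝓝 (-slopeOfFlux q)) :=
      (continuous_slopeOfFlux.continuousAt.tendsto.comp hflux).neg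
    exact slopeOfFlux_eq_zero (neg_eq_zero.1
      (limit_deriv_eq_zero (fun r _ => hv.hasDerivAt_flux_form r) hl h1))
  have hkl : k l = 0 := by
    have h1 : Tendsto (fun r : ℝ => (n : ℝ) / r) atTop (𝓝 0) :=
      tendsto_const_nhds.div_atTop tendsto_id
    have h2 := (hk.continuousAt.tendsto.comp hl).sub (h1.mul hflux)
    rw [zero_mul, sub_zero] at h2
    exact limit_deriv_eq_zero (fun r hr => hv.hasDerivAt_flux hk hr) hflux h2
  refine ⟨l, hl0, ?_, hl, hkl, ?_⟩
  · have h1 : v 1 < ξ := by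
      rw [← hv.apply_zero]
      exact hanti (mem_Ici.2 le_rfl) (mem_Ici.2 zero_le_one) one_pos
    refine lt_of_le_of_lt (le_of_tendsto hl ?_) h1
    filter_upwards [eventually_ge_atTop 1] with r hr
    exact hanti.antitoneOn (mem_Ici.2 zero_le_one) (mem_Ici.2 (by linarith)) hr
  · have h1 : Tendsto (energy n k v) atTop (𝓝 (√(1 + q ^ 2) - 1 + primitiveF k l)) :=
      (((hflux.pow 2).const_add 1).sqrt.sub_const 1).add hΦ
    rw [hq0] at h1
    have := tendsto_nhds_unique hE h1
    simp at this
    linarith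

/-- If the energy of a positive profile stays above `e ≥ 0` as long as the profile decreases,
then it decreases forever, to the limit `0`. Indeed at a first critical radius, or at a limit
other than `0`, the value would lie in `(0, α]`, where the energy is negative. -/
lemma tendsto_zero_of_energy_bound (hv : IsRadialProfile n k ξ v) (hk : Continuous k) {α β e : ℝ}
    (hneg : ∀ s ∈ Ioo 0 α, k s < 0) (hpos : ∀ s ∈ Ioo α β, 0 < k s) (hξ : ξ ∈ Ioo α β)
    (hvpos : ∀ r, 0 ≤ r → 0 < v r) (he : 0 ≤ e)
    (hE : ∀ r, 0 < r → (∀ s ∈ Ioo 0 r, 0 < flux n k v s) → e ≤ energy n k v r) :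
    (∀ r, 0 < r → 0 < flux n k v r) ∧ Tendsto v atTop (𝓝 0) ∧ e ≤ 0 := by
  have hp : ∀ r, 0 < r → 0 < flux n k v r := by
    by_contra! hcon
    obtain ⟨r, hr, hpr⟩ := hcon
    obtain ⟨δ, hδ, hδpos⟩ := hv.exists_flux_pos_near_zero hk (hpos ξ hξ)
    obtain ⟨R, hR, hR0, hRpos⟩ := exists_first_zero (hv.continuous_flux hk) hδ hδpos hr hpr
    have h1 := deriv_nonpos_of_first_zero hR (hv.hasDerivAt_flux hk hR) hR0 hRpos
    rw [hR0, mul_zero, sub_zero] at h1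
    have h2 : v R < ξ := by
      rw [← hv.apply_zero]
      exact hv.strictAntiOn_of_flux_pos (convex_Icc 0 R) (by simpa using hRpos)
        (left_mem_Icc.2 hR.le) (right_mem_Icc.2 hR.le) hR
    have h3 : v R ≤ α := by
      by_contra! h
      exact absurd (hpos _ ⟨h, h2.trans hξ.2⟩) (not_lt.2 h1)
    have h4 := primitiveF_neg_of_neg hk hneg ⟨hvpos R hR.le, h3⟩
    have h5 := hE R hR hRpos
    rw [energy_of_flux_eq_zero hR0] at h5
    linarith
  obtain ⟨l, hl0, hlξ, hl, hkl, hel⟩ := hv.exists_limit hk (fun r hr => (hvpos r hr).le) hp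
    fun r hr => hE r hr fun s hs => hp s hs.1
  have hlα : l ≤ α := by
    by_contra! h
    exact (hpos l ⟨h, hlξ.trans hξ.2⟩).ne' hkl
  have hl' : l = 0 := by
    by_contra h
    have := primitiveF_neg_of_neg hk hneg ⟨lt_of_le_of_ne hl0 (Ne.symm h), hlα⟩
    linarith
  subst hl'
  rw [primitiveF_zero] at hel
  exact ⟨hp, hl, hel⟩

end IsRadialProfile

/-! ### Profiles that cross zero -/

/-- A profile that stays above `ξ₁`, a value of positive potential `c`, up to a large radius must
cross zero: past that radius the dissipation coefficient `n / r` is too small to use up the energy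
`c` during the descent from `ξ₁`. The radius does not depend on the values of `k` beyond `ξ₁`. -/
theorem exists_crossing_radius (n : ℕ) {ξ₁ c C : ℝ} (hξ₁ : 0 < ξ₁) (hc : 0 < c) (hC : 0 ≤ C) :
    ∃ R₀ > 0, ∀ (k v : ℝ → ℝ) (L : NNReal) (α β ξ : ℝ), LipschitzWith L k → k 0 = 0 →
      (∀ s ∈ Ioo 0 α, k s < 0) → (∀ s ∈ Ioo α β, 0 < k s) → 0 < α → ξ₁ ∈ Ioo α β → ξ ∈ Ioo α β →
      primitiveF k ξ₁ = c → (∀ s ∈ Icc 0 ξ₁, -C ≤ primitiveF k s) → IsRadialProfile n k ξ v →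
      (∀ r ∈ Icc 0 R₀, ξ₁ ≤ v r) → ∃ r, 0 ≤ r ∧ v r < 0 := by
  set C₁ := C + 1 with hC₁
  set K := c / (2 * ξ₁ * (c + C₁)) with hK
  have hK0 : 0 < K := by positivity
  have hexp : C₁ + c / 2 ≤ (c + C₁) * Real.exp (-(K * ξ₁)) := by
    have h1 := Real.add_one_le_exp (-(K * ξ₁))
    have h2 : (c + C₁) * (K * ξ₁) = c / 2 := by
      have : 0 < c + C₁ := by positivity
      rw [hK]
      field_simp
    have h3 : 0 ≤ c + C₁ := by positivity
    nlinarith [mul_le_mul_of_nonneg_left h1 h3]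
  refine ⟨(n + 1) / K, by positivity, ?_⟩
  intro k v L α β ξ hk hk0 hneg hpos hα hξ₁' hξ hΦ hΦC hv hR₀
  set R₀ : ℝ := (n + 1) / K with hR₀def
  have hR₀0 : 0 < R₀ := by positivity
  by_contra! hnn
  have hvpos : ∀ r, 0 ≤ r → 0 < v r := fun r hr =>
    hv.pos_of_nonneg hk hk0 (hα.trans hξ.1) hnn hr
  have hE : ∀ r, 0 < r → (∀ s ∈ Ioo 0 r, 0 < flux n k v s) → c / 2 ≤ energy n k v r := by
    intro r hr hp
    have hanti : StrictAntiOn v (Icc 0 r) :=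
      hv.strictAntiOn_of_flux_pos (convex_Icc 0 r) (by simpa using hp)
    rcases le_or_gt ξ₁ (v r) with h | h
    · have h1 : v r < ξ := by
        rw [← hv.apply_zero]
        exact hanti (left_mem_Icc.2 hr.le) (right_mem_Icc.2 hr.le) hr
      have h2 : MonotoneOn (primitiveF k) (Icc ξ₁ (v r)) := by
        refine monotoneOn_of_hasDerivWithinAt_nonneg (convex_Icc _ _)
          (continuous_primitiveF hk.continuous).continuousOn
          (fun s _ => (hasDerivAt_primitiveF hk.continuous s).hasDerivWithinAt) fun s hs => ?_
        rw [interior_Icc] at hs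
        exact (hpos s ⟨hξ₁'.1.trans hs.1, hs.2.trans (h1.trans hξ.2)⟩).le
      have h3 := h2 (left_mem_Icc.2 h) (right_mem_Icc.2 h) h
      have h4 := primitiveF_le_energy n k v r
      linarith
    · have hRr : R₀ ≤ r := by
        by_contra! h'
        exact absurd (hR₀ r ⟨hr.le, h'.le⟩) (not_le.2 h)
      obtain ⟨R, hR, hvR⟩ := intermediate_value_Icc' hRr hv.continuous.continuousOn
        ⟨h.le, hR₀ R₀ ⟨hR₀0.le, le_rfl⟩⟩
      have hR0 : 0 < R := hR₀0.trans_le hR.1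
      have hvs : ∀ s ∈ Icc R r, v s ∈ Icc 0 ξ₁ := fun s hs =>
        ⟨hnn s (hR0.le.trans hs.1), by
          rw [← hvR]
          exact hanti.antitoneOn ⟨hR0.le, hR.2⟩ ⟨hR0.le.trans hs.1, hs.2⟩ hs.1⟩
      have hmono : MonotoneOn (fun s => (energy n k v s + C₁) * Real.exp (-(K * v s)))
          (Icc R r) := by
        have hd : ∀ s ∈ interior (Icc R r), HasDerivAt
            (fun s => (energy n k v s + C₁) * Real.exp (-(K * v s))) _ s := fun s hs => by
          rw [interior_Icc] at hs
          exact ((hv.hasDerivAt_energy hk.continuous (hR0.trans hs.1)).add_const C₁).mul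
            ((hv.hasDerivAt_flux_form s).const_mul K).neg.exp
        refine monotoneOn_of_hasDerivWithinAt_nonneg (convex_Icc R r) ?_
          (fun s hs => (hd s hs).hasDerivWithinAt) fun s hs => ?_
        · have h1 := hv.continuous
          have h2 : Continuous (energy n k v) := hv.continuous_energy hk.continuous
          exact (by fun_prop : Continuous
            fun s => (energy n k v s + C₁) * Real.exp (-(K * v s))).continuousOn
        · rw [interior_Icc] at hs
          have hs0 : 0 < s := hR0.trans hs.1
          have hps := hp s ⟨hs0, hs.2⟩
          have hgs := slopeOfFlux_pos hps
          have e1 : (n : ℝ) / s ≤ K := by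
            have : (n + 1) / K ≤ s := hR.1.trans hs.1.le
            rw [div_le_iff₀ hK0] at this
            rw [div_le_iff₀ hs0]
            linarith
          have e2 : flux n k v s ≤ energy n k v s + C₁ := by
            have h1 := (le_abs_self _).trans (abs_lt_sqrt_one_add_sq (flux n k v s)).le
            have h2 := hΦC (v s) (hvs s ⟨hs.1.le, hs.2.le⟩)
            unfold energy
            linarith
          have e3 : (n : ℝ) / s * flux n k v s ≤ K * (energy n k v s + C₁) :=
            mul_le_mul e1 e2 hps.le hK0.le
          have e4 : 0 ≤ (K * (energy n k v s + C₁) - n / s * flux n k v s) *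
              slopeOfFlux (flux n k v s) := mul_nonneg (by linarith) hgs.le
          refine (mul_nonneg (Real.exp_pos (-(K * v s))).le e4).trans (le_of_eq ?_)
          rw [Pi.neg_apply]
          ring
      have h1 := hmono (left_mem_Icc.2 hR.2) (right_mem_Icc.2 hR.2) hR.2
      simp only [hvR] at h1
      have h2 : c ≤ energy n k v R := by
        rw [← hΦ, ← hvR]
        exact primitiveF_le_energy n k v R
      have h3 : (c + C₁) * Real.exp (-(K * ξ₁)) ≤
          (energy n k v R + C₁) * Real.exp (-(K * ξ₁)) := by gcongr
      have h4 : Real.exp (-(K * v r)) ≤ 1 := Real.exp_le_one_iff.2 (by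
        have := mul_nonneg hK0.le (hnn r hr.le)
        linarith)
      have h5 : 0 < (energy n k v r + C₁) * Real.exp (-(K * v r)) := by
        have : 0 < C₁ + c / 2 := by positivity
        linarith
      have h6 : 0 < energy n k v r + C₁ := pos_of_mul_pos_left h5 (Real.exp_pos _).le
      have h7 : (energy n k v r + C₁) * Real.exp (-(K * v r)) ≤ energy n k v r + C₁ :=
        mul_le_of_le_one_right h6.le h4
      linarith
  have := (hv.tendsto_zero_of_energy_bound hk.continuous hneg hpos hξ hvpos (by positivity) hE).2.2
  linarith

/-! ### The shooting argument -/

lemma continuous_of_abs_sub_le {F : ℝ → ℝ} {C : ℝ} (h : ∀ a b, |F a - F b| ≤ C * |a - b|) :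
    Continuous F :=
  (LipschitzWith.of_dist_le' (K := C) fun a b => by simpa [Real.dist_eq] using h a b).continuous

/-- Shooting: the least central value `ξ` such that profiles arbitrarily close to it cross zero
gives a decreasing profile with limit `0`. The set of central values whose profile crosses zero is
open, and so is the set of those whose energy becomes negative while the profile is still positive.
They are disjoint as the energy is nonnegative below zero, so `ξ` belongs to neither. -/
theorem exists_decaying_profile (n : ℕ) {k : ℝ → ℝ} {L : NNReal} (hk : LipschitzWith L k)
    (hk0 : ∀ s ≤ 0, k s = 0) {α β : ℝ} (hα : 0 < α)
    (hneg : ∀ s ∈ Ioo 0 α, k s < 0) (hpos : ∀ s ∈ Ioo α β, 0 < k s) {v : ℝ → ℝ → ℝ} {l : ℝ}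
    (hl : 0 < l) (hv : ∀ ξ, IsRadialProfile n k ξ (v ξ))
    (hdep : ∀ ξ η r, |v ξ r - v η r| ≤ 2 * |ξ - η| * Real.exp (l * |r|))
    (hcross : ∃ ξ ∈ Ioo α β, ∃ r, 0 ≤ r ∧ v ξ r < 0) :
    ∃ ξ ∈ Ioo α β, (∀ r, 0 ≤ r → 0 < v ξ r) ∧ (∀ r, 0 < r → 0 < flux n k (v ξ) r) ∧
      Tendsto (v ξ) atTop (𝓝 0) := by
  have hkc := hk.continuous
  set A : Set ℝ := {ξ | ξ ∈ Ioo α β ∧ ∃ r, 0 ≤ r ∧ v ξ r < 0} with hA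
  have hAne : A.Nonempty := by
    obtain ⟨ξ, hξ, h⟩ := hcross
    exact ⟨ξ, hξ, h⟩
  have hAbdd : BddBelow A := ⟨α, fun ξ hξ => hξ.1.1.le⟩
  have hcv : ∀ r, Continuous fun ξ => v ξ r := fun r =>
    continuous_of_abs_sub_le (C := 2 * Real.exp (l * |r|)) fun ξ η =>
      (hdep ξ η r).trans (le_of_eq (by ring))
  have hcE : ∀ r, Continuous fun ξ => energy n k (v ξ) r := by
    intro r
    have h1 : Continuous fun ξ => flux n k (v ξ) r :=
      continuous_of_abs_sub_le (C := L * 2 / l * Real.exp (l * |r|)) fun ξ η =>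
        (abs_mul_weightedMean_sub_le n hk (hv ξ).continuous (hv η).continuous (by positivity) hl
          (hdep ξ η) r).trans (le_of_eq (by ring))
    unfold energy
    exact ((continuous_const.add (h1.pow 2)).sqrt.sub continuous_const).add
      ((continuous_primitiveF hkc).comp (hcv r))
  -- the energy is nonnegative wherever the profile is negative
  have hEneg : ∀ ξ r, v ξ r < 0 → 0 ≤ energy n k (v ξ) r := fun ξ r h =>
    (primitiveF_eq_zero_of_nonpos hk0 h.le).symm.le.trans (primitiveF_le_energy n k (v ξ) r)
  set ξ := sInf A with hξdef
  have hξβ : ξ < β := by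
    obtain ⟨η, hη⟩ := hAne
    exact (csInf_le hAbdd hη).trans_lt hη.1.2
  -- just above `α` the initial energy is negative, so the profile does not cross zero
  have hξα : α < ξ := by
    have h1 : ∀ᶠ s in 𝓝 α, primitiveF k s < 0 :=
      (continuous_primitiveF hkc).continuousAt.eventually_lt_const
        (primitiveF_neg_of_neg hkc hneg ⟨hα, le_rfl⟩)
    obtain ⟨ε, hε, h2⟩ := Metric.eventually_nhds_iff.1 h1
    refine (lt_add_of_pos_right α hε).trans_le (le_csInf hAne ?_)
    rintro η ⟨hη, r, hr, hηr⟩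
    by_contra! h
    have h3 : primitiveF k η < 0 := h2 (by
      rw [Real.dist_eq, abs_of_pos (by linarith [hη.1])]
      linarith)
    have h4 := (hv η).antitoneOn_energy hkc (mem_Ici.2 le_rfl) (mem_Ici.2 hr) hr
    rw [energy_of_flux_eq_zero (r := 0) (by simp [flux]), (hv η).apply_zero] at h4
    linarith [hEneg η r hηr]
  have hnn : ∀ r, 0 ≤ r → 0 ≤ v ξ r := by
    by_contra! hcon
    obtain ⟨r, hr, hvr⟩ := hcon
    have h1 : ∀ᶠ η in 𝓝[<] ξ, v η r < 0 :=
      ((hcv r).continuousAt.eventually_lt_const hvr).filter_mono nhdsWithin_le_nhds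
    obtain ⟨η, hη1, hη2⟩ := (h1.and (Ioo_mem_nhdsLT hξα)).exists
    exact absurd (csInf_le hAbdd (⟨⟨hη2.1, hη2.2.trans hξβ⟩, r, hr, hη1⟩ : η ∈ A))
      (not_le.2 hη2.2)
  have hvpos : ∀ r, 0 ≤ r → 0 < v ξ r := fun r hr =>
    (hv ξ).pos_of_nonneg hk (hk0 0 le_rfl) (hα.trans hξα) hnn hr
  have hE : ∀ r, 0 ≤ r → 0 ≤ energy n k (v ξ) r := by
    by_contra! hcon
    obtain ⟨r, hr, hEr⟩ := hcon
    obtain ⟨m, hm, hmin⟩ : ∃ m > 0, ∀ s ∈ Icc 0 r, m ≤ v ξ s := by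
      obtain ⟨s, hs, hs'⟩ := isCompact_Icc.exists_isMinOn (nonempty_Icc.2 hr)
        (hv ξ).continuous.continuousOn
      exact ⟨v ξ s, hvpos s hs.1, hs'⟩
    have h1 : ∀ᶠ η in 𝓝 ξ, 2 * |ξ - η| * Real.exp (l * r) < m := by
      have : Continuous fun η => 2 * |ξ - η| * Real.exp (l * r) := by fun_prop
      exact this.continuousAt.eventually_lt_const (by simpa using hm)
    have h2 : ∀ᶠ η in 𝓝 ξ, energy n k (v η) r < 0 :=
      (hcE r).continuousAt.eventually_lt_const hEr
    obtain ⟨η, ⟨_, s, hs, hηs⟩, hη1, hη2⟩ := ((mem_closure_iff_frequently.1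
      (csInf_mem_closure hAne hAbdd)).and_eventually (h1.and h2)).exists
    rcases le_total s r with hsr | hrs
    · have h3 := hdep ξ η s
      have h4 : 2 * |ξ - η| * Real.exp (l * |s|) ≤ 2 * |ξ - η| * Real.exp (l * r) := by
        rw [abs_of_nonneg hs]
        gcongr
      linarith [le_abs_self (v ξ s - v η s), hmin s ⟨hs, hsr⟩]
    · have h3 := (hv η).antitoneOn_energy hkc (mem_Ici.2 hr) (mem_Ici.2 hs) hrs
      linarith [hEneg η s hηs]
  obtain ⟨h1, h2, -⟩ := (hv ξ).tendsto_zero_of_energy_bound hkc hneg hpos ⟨hξα, hξβ⟩ hvpos le_rfl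
    fun r hr _ => hE r hr.le
  exact ⟨ξ, ⟨hξα, hξβ⟩, hvpos, h1, h2⟩

/-! ### Radial fields and the passage to `ℝᴺ` -/

section RadialField

variable {E : Type*} [NormedAddCommGroup E] [InnerProductSpace ℝ E]

lemma hasFDerivAt_norm_of_ne_zero {x : E} (hx : x ≠ 0) :
    HasFDerivAt (fun y : E => ‖y‖) (‖x‖⁻¹ • innerSL ℝ x) x := by
  have h1 := (hasStrictFDerivAt_norm_sq x).hasFDerivAt.sqrt
    (by have := norm_pos_iff.2 hx; positivity)
  simp only [Real.sqrt_sq (norm_nonneg _)] at h1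
  refine h1.congr_fderiv ?_
  ext y
  simp
  field_simp

/-- The derivative of the radial field `x ↦ B(‖x‖) x`, where `Z(r) = r B'(r)`. -/
noncomputable def radialFieldDeriv (B Z : ℝ → ℝ) (x : E) : E →L[ℝ] E :=
  B ‖x‖ • ContinuousLinearMap.id ℝ E + (Z ‖x‖ / ‖x‖ ^ 2) • (innerSL ℝ x).smulRight x

variable {B Z : ℝ → ℝ}

/-- At the origin only continuity of `B` is needed for the derivative. -/
lemma hasFDerivAt_radialField (hB : Continuous B) (hBZ : ∀ r > 0, HasDerivAt B (Z r / r) r)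
    (x : E) : HasFDerivAt (fun y : E => B ‖y‖ • y) (radialFieldDeriv B Z x) x := by
  rcases eq_or_ne x 0 with rfl | hx
  · rw [hasFDerivAt_iff_isLittleO_nhds_zero]
    have h1 : Tendsto (fun y : E => B ‖y‖ - B 0) (𝓝 0) (𝓝 0) := by
      have : Continuous fun y : E => B ‖y‖ - B 0 := by fun_prop
      simpa using this.tendsto 0
    have h2 := ((Asymptotics.isLittleO_one_iff ℝ).2 h1).smul_isBigO
      (Asymptotics.isBigO_refl (fun y : E => y) (𝓝 0))
    simp only [one_smul] at h2
    refine h2.congr_left fun y => ?_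
    simp [radialFieldDeriv, sub_smul]
  · have hx' := norm_pos_iff.2 hx
    have h1 := ((hBZ ‖x‖ hx').comp_hasFDerivAt x (hasFDerivAt_norm_of_ne_zero hx)).smul
      (hasFDerivAt_id x)
    refine h1.congr_fderiv ?_
    ext1 y
    simp only [radialFieldDeriv, add_apply, smul_apply,
      ContinuousLinearMap.smulRight_apply, ContinuousLinearMap.id_apply, Function.comp_apply, id,
      smul_smul, smul_eq_mul]
    congr 2
    field_simp

lemma continuous_radialFieldDeriv (hB : Continuous B) (hZ : Continuous Z) (hZ0 : Z 0 = 0) :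
    Continuous (radialFieldDeriv (E := E) B Z) := by
  unfold radialFieldDeriv
  refine Continuous.add (by fun_prop) (continuous_iff_continuousAt.2 fun x => ?_)
  rcases eq_or_ne x 0 with rfl | hx
  · have h1 : Tendsto (fun y : E => |Z ‖y‖|) (𝓝 0) (𝓝 0) := by
      have : Continuous fun y : E => |Z ‖y‖| := by fun_prop
      simpa [hZ0] using this.tendsto 0
    rw [ContinuousAt, norm_zero, hZ0, zero_div, zero_smul]
    refine squeeze_zero_norm (fun y => ?_) h1
    rw [norm_smul, ContinuousLinearMap.norm_smulRight_apply, innerSL_apply_norm, norm_div,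
      norm_pow, norm_norm, Real.norm_eq_abs]
    rcases eq_or_ne ‖y‖ 0 with h | h
    · simp [h]
    · exact le_of_eq (by field_simp)
  · have h1 : Continuous fun y : E => (innerSL ℝ y).smulRight y := by
      have h2 := (ContinuousLinearMap.smulRightL ℝ E E).continuous₂
      exact h2.comp ((innerSL ℝ).continuous.prodMk continuous_id)
    have h2 : ContinuousAt (fun y : E => Z ‖y‖ / ‖y‖ ^ 2) x :=
      (hZ.comp continuous_norm).continuousAt.div (by fun_prop)
        (pow_ne_zero 2 (norm_ne_zero_iff.2 hx))
    exact h2.smul h1.continuousAt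

lemma contDiff_one_radialField (hB : Continuous B) (hZ : Continuous Z) (hZ0 : Z 0 = 0)
    (hBZ : ∀ r > 0, HasDerivAt B (Z r / r) r) : ContDiff ℝ 1 fun y : E => B ‖y‖ • y :=
  contDiff_one_iff_hasFDerivAt.2
    ⟨radialFieldDeriv B Z, continuous_radialFieldDeriv hB hZ hZ0, hasFDerivAt_radialField hB hBZ⟩

/-- The gradient whose flux is `y`: the inverse of `w ↦ w / √(1 - |w|²)`. -/
noncomputable def gradientOfFlux (y : E) : E := (√(1 + ‖y‖ ^ 2))⁻¹ • y

lemma contDiff_gradientOfFlux {m : WithTop ℕ∞} : ContDiff ℝ m (gradientOfFlux (E := E)) := by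
  unfold gradientOfFlux
  refine ContDiff.smul (ContDiff.inv (ContDiff.sqrt ?_ fun y => by positivity) fun y => ?_)
    contDiff_id
  · exact contDiff_const.add (contDiff_norm_sq ℝ)
  · exact (sqrt_one_add_sq_pos ‖y‖).ne'

lemma norm_gradientOfFlux_sq (y : E) :
    ‖gradientOfFlux y‖ ^ 2 = ‖y‖ ^ 2 / (1 + ‖y‖ ^ 2) := by
  rw [gradientOfFlux, norm_smul, norm_inv, Real.norm_eq_abs, abs_of_pos (sqrt_one_add_sq_pos _),
    mul_pow, inv_pow, Real.sq_sqrt (by positivity)]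
  ring

lemma norm_gradientOfFlux_lt_one (y : E) : ‖gradientOfFlux y‖ < 1 := by
  have h : ‖gradientOfFlux y‖ ^ 2 < 1 := by
    rw [norm_gradientOfFlux_sq, div_lt_one (by positivity)]
    linarith
  nlinarith [norm_nonneg (gradientOfFlux y)]

lemma inv_sqrt_smul_gradientOfFlux (y : E) :
    (√(1 - ‖gradientOfFlux y‖ ^ 2))⁻¹ • gradientOfFlux y = y := by
  have h : 1 - ‖gradientOfFlux y‖ ^ 2 = (1 + ‖y‖ ^ 2)⁻¹ := by
    rw [norm_gradientOfFlux_sq]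
    field_simp
    ring
  rw [h, Real.sqrt_inv, inv_inv, gradientOfFlux, smul_smul,
    mul_inv_cancel₀ (sqrt_one_add_sq_pos _).ne', one_smul]

end RadialField

lemma trace_radialFieldDeriv {N : ℕ} {B Z : ℝ → ℝ} (hZ0 : Z 0 = 0)
    (x : EuclideanSpace ℝ (Fin N)) :
    ∑ i : Fin N, (radialFieldDeriv B Z x (EuclideanSpace.single i (1 : ℝ))) i =
      N * B ‖x‖ + Z ‖x‖ := by
  have h : ∀ i : Fin N, (radialFieldDeriv B Z x (EuclideanSpace.single i (1 : ℝ))) i =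
      B ‖x‖ + Z ‖x‖ / ‖x‖ ^ 2 * x i ^ 2 := by
    intro i
    simp only [radialFieldDeriv, add_apply, smul_apply, ContinuousLinearMap.smulRight_apply,
      ContinuousLinearMap.id_apply, innerSL_apply_apply, EuclideanSpace.inner_single_right,
      PiLp.add_apply, PiLp.smul_apply, smul_eq_mul, PiLp.single_apply]
    simp only [if_true, conj_trivial]
    ring
  simp only [h]
  rw [Finset.sum_add_distrib, ← Finset.mul_sum, ← EuclideanSpace.real_norm_sq_eq]
  rcases eq_or_ne ‖x‖ 0 with hx | hx
  · simp [hx, hZ0]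
  · simp
    field_simp

namespace IsRadialProfile

variable {n : ℕ} {k v : ℝ → ℝ} {ξ : ℝ}

lemma hasDerivAt_weightedMean (hv : IsRadialProfile n k ξ v) (hk : Continuous k) {r : ℝ}
    (hr : 0 < r) : HasDerivAt (weightedMean n k v)
      ((k (v r) - (n + 1) * weightedMean n k v r) / r) r := by
  have h := ((hv.hasDerivAt_flux hk hr).div (hasDerivAt_id r) hr.ne').congr_of_eventuallyEq
    (f₁ := weightedMean n k v) (by
      filter_upwards [lt_mem_nhds hr] with s hs
      simp only [Pi.div_apply, flux, id]
      field_simp)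
  refine h.congr_deriv ?_
  simp only [flux, id]
  field_simp
  ring

lemma weightedMean_zero (hv : IsRadialProfile n k ξ v) :
    (n + 1) * weightedMean n k v 0 = k ξ := by
  have : (n : ℝ) + 1 ≠ 0 := by positivity
  simp [weightedMean, hv.apply_zero]
  field_simp

/-- The gradient of the radial function `v(|x|)` is the one with flux `-A(|x|) x`, where `A` is
the weighted mean. -/
lemma hasGradientAt_comp_norm {E : Type*} [NormedAddCommGroup E] [InnerProductSpace ℝ E]
    [CompleteSpace E] (hv : IsRadialProfile n k ξ v) (x : E) :
    HasGradientAt (fun y : E => v ‖y‖) (gradientOfFlux (-weightedMean n k v ‖x‖ • x)) x := by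
  rw [hasGradientAt_iff_hasFDerivAt]
  rcases eq_or_ne x 0 with rfl | hx
  · have h1 := hv.hasDerivAt 0
    rw [zero_mul, hasDerivAt_iff_isLittleO_nhds_zero] at h1
    rw [hasFDerivAt_iff_isLittleO_nhds_zero]
    have h2 : Tendsto (fun y : E => ‖y‖) (𝓝 0) (𝓝 0) := by
      simpa using (continuous_norm (E := E)).tendsto 0
    have h3 := (h1.comp_tendsto h2).norm_right.trans_isBigO
      (Asymptotics.IsBigO.of_bound 1 (g := fun y : E => y) (by simp))
    refine h3.congr_left fun y => ?_
    simp [slopeOfFlux, gradientOfFlux]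
  · have h1 := (hv.hasDerivAt ‖x‖).comp_hasFDerivAt x (hasFDerivAt_norm_of_ne_zero hx)
    refine h1.congr_fderiv ?_
    ext1 y
    have hx' := norm_pos_iff.2 hx
    have h2 : ‖-weightedMean n k v ‖x‖ • x‖ ^ 2 = (‖x‖ * weightedMean n k v ‖x‖) ^ 2 := by
      rw [norm_smul, mul_pow, norm_neg, Real.norm_eq_abs, sq_abs]
      ring
    rw [InnerProductSpace.toDual_apply_apply, gradientOfFlux, h2]
    simp only [slopeOfFlux, inner_smul_left, inner_neg_left, neg_smul]
    simp
    field_simp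

/-- A positive decreasing profile with limit `0` gives a radially decreasing ground state. -/
theorem isGroundState (hv : IsRadialProfile n k ξ v) (hk : Continuous k)
    (hpos : ∀ r, 0 ≤ r → 0 < v r) (hlim : Tendsto v atTop (𝓝 0)) {f : ℝ → ℝ}
    (hf : ∀ r, 0 ≤ r → f (v r) = k (v r)) :
    IsGroundState f fun x : EuclideanSpace ℝ (Fin (n + 1)) => v ‖x‖ := by
  have hA := continuous_weightedMean n hk hv.continuous
  have hvc := hv.continuous
  set B : ℝ → ℝ := fun r => -weightedMean n k v r with hBdef
  set Z : ℝ → ℝ := fun r => -(k (v r) - (n + 1) * weightedMean n k v r) with hZdef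
  have hB : Continuous B := hA.neg
  have hZ : Continuous Z := by fun_prop
  have hZ0 : Z 0 = 0 := by
    rw [hZdef]
    simp only
    rw [hv.weightedMean_zero, hv.apply_zero, sub_self, neg_zero]
  have hBZ : ∀ r > 0, HasDerivAt B (Z r / r) r := fun r hr =>
    (hv.hasDerivAt_weightedMean hk hr).neg.congr_deriv (by rw [hZdef]; ring)
  have hgrad : ∀ x : EuclideanSpace ℝ (Fin (n + 1)),
      HasGradientAt (fun y => v ‖y‖) (gradientOfFlux (B ‖x‖ • x)) x := hv.hasGradientAt_comp_norm
  have hgrad' : ∀ x : EuclideanSpace ℝ (Fin (n + 1)),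
      gradient (fun y => v ‖y‖) x = gradientOfFlux (B ‖x‖ • x) := fun x => (hgrad x).gradient
  refine ⟨?_, fun x => ?_, fun x => ?_, fun x => hpos _ (norm_nonneg x),
    hlim.comp tendsto_comap⟩
  · refine (contDiff_succ_iff_hasFDerivAt (n := 1)).2 ⟨_, ?_, fun x => (hgrad x).hasFDerivAt⟩
    exact (InnerProductSpace.toDual ℝ (EuclideanSpace ℝ (Fin (n + 1)))).contDiff.comp
      (contDiff_gradientOfFlux.comp (contDiff_one_radialField hB hZ hZ0 hBZ))
  · rw [hgrad']
    exact norm_gradientOfFlux_lt_one _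
  · have h1 : minkowskiFlux (fun y : EuclideanSpace ℝ (Fin (n + 1)) => v ‖y‖) =
        fun y => B ‖y‖ • y := by
      funext y
      rw [minkowskiFlux, hgrad', inv_sqrt_smul_gradientOfFlux]
    rw [divergence, h1, (hasFDerivAt_radialField hB hBZ x).fderiv, trace_radialFieldDeriv hZ0,
      hf _ (norm_nonneg x)]
    simp only [hBdef, hZdef]
    push_cast
    ring

end IsRadialProfile

/-! ### Truncation of the nonlinearity -/

/-- The nonlinearity `f` frozen outside `[0, M]`. -/
noncomputable def truncate (f : ℝ → ℝ) (M : ℝ) (s : ℝ) : ℝ := f (max 0 (min M s))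

lemma truncate_eq {f : ℝ → ℝ} {M s : ℝ} (hs : s ∈ Icc 0 M) : truncate f M s = f s := by
  rw [truncate, min_eq_right hs.2, max_eq_right hs.1]

lemma truncate_of_nonpos {f : ℝ → ℝ} (h0 : f 0 = 0) {M s : ℝ} (hM : 0 ≤ M) (hs : s ≤ 0) :
    truncate f M s = 0 := by
  rw [truncate, min_eq_right (hs.trans hM), max_eq_left hs, h0]

lemma exists_lipschitzWith_truncate {f : ℝ → ℝ} (hf : LocallyLipschitzOn (Ici 0) f) {M : ℝ}
    (hM : 0 ≤ M) : ∃ L, LipschitzWith L (truncate f M) := by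
  obtain ⟨L, hL⟩ := LocallyLipschitzOn.exists_lipschitzOnWith_of_compact
    (isCompact_Icc (a := (0 : ℝ)) (b := M)) (hf.mono Icc_subset_Ici_self)
  exact ⟨_, hL.to_restrict.comp (LipschitzWith.projIcc hM)⟩

lemma primitiveF_truncate {f : ℝ → ℝ} {M s : ℝ} (hs : s ∈ Icc 0 M) :
    primitiveF (truncate f M) s = primitiveF f s := by
  refine intervalIntegral.integral_congr fun t ht => ?_
  rw [uIcc_of_le hs.1] at ht
  exact truncate_eq ⟨ht.1, ht.2.trans hs.2⟩

lemma exists_groundState_of_crossing (n : ℕ) {f : ℝ → ℝ} (hf : LocallyLipschitzOn (Ici 0) f)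
    (h0 : f 0 = 0) {α M : ℝ} (hα : 0 < α) (hαM : α < M) (hneg : ∀ s ∈ Ioo 0 α, f s < 0)
    (hpos : ∀ s ∈ Ioo α M, 0 < f s)
    (hcross : ∀ (v : ℝ → ℝ → ℝ) (l : ℝ), (∀ ξ, IsRadialProfile n (truncate f M) ξ (v ξ)) →
      (∀ ξ η r, |v ξ r - v η r| ≤ 2 * |ξ - η| * Real.exp (l * |r|)) →
      (f M = 0 → ∀ r, v M r = M) → ∃ ξ ∈ Ioo α M, ∃ r, 0 ≤ r ∧ v ξ r < 0) :
    ∃ u : EuclideanSpace ℝ (Fin (n + 1)) → ℝ, IsGroundState f u ∧ IsRadiallyDecreasing u := by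
  have hM : 0 < M := hα.trans hαM
  obtain ⟨L, hL⟩ := exists_lipschitzWith_truncate hf hM.le
  obtain ⟨v, l, hl, hv, hdep, hconst⟩ := exists_radialProfile n hL
  obtain ⟨ξ, hξ, hvpos, hp, hlim⟩ := exists_decaying_profile n hL
    (fun s hs => truncate_of_nonpos h0 hM.le hs) hα
    (fun s hs => by
      rw [truncate_eq ⟨hs.1.le, (hs.2.trans hαM).le⟩]
      exact hneg s hs)
    (fun s hs => by
      rw [truncate_eq ⟨(hα.trans hs.1).le, hs.2.le⟩]
      exact hpos s hs) hl hv hdep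
    (hcross v l hv hdep fun h => hconst M (by rw [truncate_eq ⟨hM.le, le_rfl⟩, h]))
  have hanti : StrictAntiOn (v ξ) (Ici 0) :=
    (hv ξ).strictAntiOn_of_flux_pos (convex_Ici 0) fun r hr => hp r (by simpa using hr)
  refine ⟨fun x => v ξ ‖x‖, (hv ξ).isGroundState hL.continuous hvpos hlim fun r hr => ?_,
    v ξ, hanti, fun x => rfl⟩
  refine (truncate_eq ⟨(hvpos r hr).le, ?_⟩).symm
  have := hanti.antitoneOn (mem_Ici.2 le_rfl) (mem_Ici.2 hr) hr
  rw [(hv ξ).apply_zero] at this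
  exact this.trans hξ.2.le

/-! ### Consequences of the hypotheses on `f` -/

lemma neg_of_lt_alphaOf {f : ℝ → ℝ} {s : ℝ} (hs : s ∈ Ioo 0 (alphaOf f)) : f s < 0 := by
  by_contra! h
  exact notMem_of_lt_csInf hs.2 ⟨0, fun t ht => ht.1.le⟩ ⟨hs.1, h⟩

/-- Nothing is assumed about `f` on `(-∞, 0)`, so `f` is replaced there by its value at `0`. -/
lemma continuous_comp_max_zero {f : ℝ → ℝ} (hf : LocallyLipschitzOn (Ici 0) f) :
    Continuous fun s => f (max 0 s) :=
  hf.continuousOn.comp_continuous (by fun_prop) fun s => le_max_left 0 s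

lemma primitiveF_comp_max_zero {f : ℝ → ℝ} {s : ℝ} (hs : 0 ≤ s) :
    primitiveF (fun s => f (max 0 s)) s = primitiveF f s := by
  refine intervalIntegral.integral_congr fun t ht => ?_
  rw [uIcc_of_le hs] at ht
  simp only [max_eq_right ht.1]

/-- There is a value of positive potential up to which `f` stays positive. -/
lemma exists_primitiveF_pos {f : ℝ → ℝ} (hf : LocallyLipschitzOn (Ici 0) f) (h3 : CondF3 f)
    (h5 : CondF5 f) (h6 : CondF6 f) :
    ∃ ξ₁, alphaOf f < ξ₁ ∧ 0 < primitiveF f ξ₁ ∧ ∀ s ∈ Ioc (alphaOf f) ξ₁, 0 < f s := by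
  have hα : 0 < alphaOf f := h3
  set α := alphaOf f with hαdef
  set g : ℝ → ℝ := fun s => f (max 0 s) with hg
  have hgc : Continuous g := continuous_comp_max_zero hf
  have hgf : ∀ s, 0 ≤ s → g s = f s := fun s hs => by simp only [hg, max_eq_right hs]
  have hgF : ∀ s, 0 ≤ s → primitiveF g s = primitiveF f s := fun s hs =>
    primitiveF_comp_max_zero hs
  have hFneg : ∀ s ∈ Ioc 0 α, primitiveF g s < 0 := fun s hs =>
    primitiveF_neg_of_neg hgc (fun t ht => by
      rw [hgf t ht.1.le]
      exact neg_of_lt_alphaOf ht) hs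
  set S : Set ℝ := {ξ : ℝ | 0 < ξ ∧ 0 < primitiveF f ξ} with hS
  have hSne : S.Nonempty := h5
  have hSα : ∀ s ∈ S, α < s := by
    intro s hs
    by_contra! h
    have := hFneg s ⟨hs.1, h⟩
    rw [hgF s hs.1.le] at this
    linarith [hs.2]
  have hbdd : BddBelow S := ⟨α, fun s hs => (hSα s hs).le⟩
  have hξα : α ≤ sInf S := le_csInf hSne fun s hs => (hSα s hs).le
  have hξF : 0 ≤ primitiveF g (sInf S) := by
    have hcl : IsClosed {s | 0 ≤ primitiveF g s} :=
      isClosed_le continuous_const (continuous_primitiveF hgc)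
    exact hcl.closure_subset_iff.2 (fun s hs => by
      rw [mem_ofPred_eq, hgF s hs.1.le]
      exact hs.2.le) (csInf_mem_closure hSne hbdd)
  have hξα' : α < sInf S := by
    refine lt_of_le_of_ne hξα fun h => ?_
    rw [← h] at hξF
    linarith [hFneg α ⟨hα, le_rfl⟩]
  have hξf : 0 < g (sInf S) := by
    rw [hgf _ (hα.trans hξα').le]
    exact h6 _ ⟨hξα', le_rfl⟩
  obtain ⟨ε, hε, hball⟩ := Metric.eventually_nhds_iff.1
    (hgc.continuousAt.eventually_const_lt hξf)
  obtain ⟨ξ₁, hξ₁, hlt⟩ := exists_lt_of_csInf_lt hSne (lt_add_of_pos_right (sInf S) hε)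
  refine ⟨ξ₁, hSα ξ₁ hξ₁, hξ₁.2, fun s hs => ?_⟩
  rcases le_total s (sInf S) with h | h
  · exact h6 s ⟨hs.1, h⟩
  · rw [← hgf s (hα.trans hs.1).le]
    refine hball ?_
    rw [Real.dist_eq, abs_of_nonneg (by linarith)]
    linarith [hs.2]

/-- Either `f` is positive on `(α, ∞)`, or `f` has a first zero `β` beyond `α`. -/
lemma pos_or_exists_first_zero {f : ℝ → ℝ} (hf : LocallyLipschitzOn (Ici 0) f) {α ξ₁ : ℝ}
    (hα : 0 < α) (hξ₁ : α < ξ₁) (hpos : ∀ s ∈ Ioc α ξ₁, 0 < f s) :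
    (∀ s, α < s → 0 < f s) ∨ ∃ β, ξ₁ < β ∧ f β = 0 ∧ ∀ s ∈ Ioo α β, 0 < f s := by
  by_cases h : ∀ s, α < s → 0 < f s
  · exact Or.inl h
  right
  push Not at h
  obtain ⟨r, hr, hfr⟩ := h
  have hξr : 0 < r - ξ₁ := by
    by_contra! h
    exact absurd (hpos r ⟨hr, by linarith⟩) (not_lt.2 hfr)
  have hc : Continuous fun t => f (max 0 (ξ₁ + t)) :=
    (continuous_comp_max_zero hf).comp (continuous_const.add continuous_id)
  have hgf : ∀ t, 0 ≤ t → f (max 0 (ξ₁ + t)) = f (ξ₁ + t) := fun t ht => by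
    rw [max_eq_right (by linarith)]
  obtain ⟨ε, hε, hball⟩ := Metric.eventually_nhds_iff.1
    ((hc.tendsto 0).eventually_const_lt (u := 0) (by
      rw [hgf 0 le_rfl, add_zero]
      exact hpos ξ₁ ⟨hξ₁, le_rfl⟩))
  obtain ⟨R, hR, hR0, hRpos⟩ := exists_first_zero hc (half_pos hε)
    (fun t ht => hball (by
      rw [Real.dist_eq, sub_zero, abs_of_pos ht.1]
      linarith [ht.2])) hξr (by rwa [hgf _ hξr.le, add_sub_cancel])
  refine ⟨ξ₁ + R, by linarith, by rwa [hgf R hR.le] at hR0, fun s hs => ?_⟩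
  rcases le_or_gt s ξ₁ with h | h
  · exact hpos s ⟨hs.1, h⟩
  · have := hRpos (s - ξ₁) ⟨by linarith, by linarith [hs.2]⟩
    rwa [hgf _ (by linarith), add_sub_cancel] at this

/-- The limit condition `CondF4` is not needed: a profile converging to `α` acquires negative energy
at a finite radius, so the shooting argument excludes it in every dimension `n + 1`. -/
theorem exists_groundState (n : ℕ) {f : ℝ → ℝ} (h0 : CondF1 f) (hf : CondF2 f) (h3 : CondF3 f)
    (h5 : CondF5 f) (h6 : CondF6 f) :
    ∃ u : EuclideanSpace ℝ (Fin (n + 1)) → ℝ, IsGroundState f u ∧ IsRadiallyDecreasing u := by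
  have hα : 0 < alphaOf f := h3
  obtain ⟨ξ₁, hξ₁, hF, hpos⟩ := exists_primitiveF_pos hf h3 h5 h6
  have hneg : ∀ s ∈ Ioo 0 (alphaOf f), f s < 0 := fun s hs => neg_of_lt_alphaOf hs
  set α := alphaOf f with hαdef
  have hξ₁0 : 0 < ξ₁ := hα.trans hξ₁
  obtain ⟨C, hC0, hC⟩ : ∃ C, 0 ≤ C ∧ ∀ s ∈ Icc 0 ξ₁, -C ≤ primitiveF f s := by
    obtain ⟨C, hC⟩ := (isCompact_Icc (a := (0 : ℝ)) (b := ξ₁)).exists_bound_of_continuousOn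
      (continuous_primitiveF (continuous_comp_max_zero hf)).continuousOn
    refine ⟨C, (norm_nonneg _).trans (hC 0 ⟨le_rfl, hξ₁0.le⟩), fun s hs => ?_⟩
    rw [← primitiveF_comp_max_zero hs.1]
    exact (abs_le.1 (hC s hs)).1
  obtain ⟨R₀, hR₀, hcross⟩ := exists_crossing_radius n hξ₁0 hF hC0
  -- a truncated profile that stays above `ξ₁` up to `R₀` crosses zero
  have key : ∀ (M ξ : ℝ) (v : ℝ → ℝ), ξ₁ < M → (∀ s ∈ Ioo α M, 0 < f s) → ξ ∈ Ioo α M →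
      IsRadialProfile n (truncate f M) ξ v → (∀ r ∈ Icc 0 R₀, ξ₁ ≤ v r) → ∃ r, 0 ≤ r ∧ v r < 0 := by
    intro M ξ v hM hposM hξ hv hvR
    have hM0 : 0 < M := hξ₁0.trans hM
    obtain ⟨L, hL⟩ := exists_lipschitzWith_truncate hf hM0.le
    refine hcross _ v L α M ξ hL (truncate_of_nonpos h0 hM0.le le_rfl) (fun s hs => ?_)
      (fun s hs => ?_) hα ⟨hξ₁, hM⟩ hξ (primitiveF_truncate ⟨hξ₁0.le, hM.le⟩) (fun s hs => ?_) hv hvR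
    · rw [truncate_eq ⟨hs.1.le, (hs.2.trans (hξ₁.trans hM)).le⟩]
      exact hneg s hs
    · rw [truncate_eq ⟨(hα.trans hs.1).le, hs.2.le⟩]
      exact hposM s hs
    · rw [primitiveF_truncate ⟨hs.1, hs.2.trans hM.le⟩]
      exact hC s hs
  rcases pos_or_exists_first_zero hf hα hξ₁ hpos with hall | ⟨β, hβ, hfβ, hposβ⟩
  · -- slopes are bounded by `1`, so starting at `ξ₁ + R₀ + 1` is high enough
    refine exists_groundState_of_crossing n hf h0 hα (M := ξ₁ + R₀ + 2) (by linarith) hneg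
      (fun s hs => hall s hs.1) fun v l hv _ _ => ?_
    have hmem : ξ₁ + R₀ + 1 ∈ Ioo α (ξ₁ + R₀ + 2) := ⟨by linarith, by linarith⟩
    refine ⟨ξ₁ + R₀ + 1, hmem,
      key _ _ _ (by linarith) (fun s hs => hall s hs.1) hmem (hv _) fun r hr => ?_⟩
    linarith [(hv (ξ₁ + R₀ + 1)).sub_le_apply hr.1, hr.2]
  · -- profiles starting close to the equilibrium `β` stay close to it for a long time
    refine exists_groundState_of_crossing n hf h0 hα (hξ₁.trans hβ) hneg hposβ
      fun v l hv hdep hconst => ?_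
    have h1 : ∀ᶠ ξ in 𝓝[<] β, 2 * |β - ξ| * Real.exp (|l| * R₀) < β - ξ₁ := by
      have : Continuous fun ξ => 2 * |β - ξ| * Real.exp (|l| * R₀) := by fun_prop
      exact (this.continuousAt.eventually_lt_const (by simpa using hβ)).filter_mono
        nhdsWithin_le_nhds
    obtain ⟨ξ, hξ1, hξ⟩ := (h1.and (Ioo_mem_nhdsLT (hξ₁.trans hβ))).exists
    refine ⟨ξ, hξ, key _ _ _ hβ hposβ hξ (hv ξ) fun r hr => ?_⟩
    have h2 := hdep β ξ r
    rw [hconst hfβ r] at h2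
    have h3 : 2 * |β - ξ| * Real.exp (l * |r|) ≤ 2 * |β - ξ| * Real.exp (|l| * R₀) := by
      rw [abs_of_nonneg hr.1]
      gcongr
      · exact hr.1
      · exact le_abs_self l
      · exact hr.2
    linarith [le_abs_self (β - v ξ r)]

theorem theorem1 (N : ℕ) (f : ℝ → ℝ)
    (h : (3 ≤ N ∧ CondF1 f ∧ CondF2 f ∧ CondF3 f ∧ CondF4 f ∧ CondF5 f ∧ CondF6 f) ∨
      (N = 2 ∧ CondF1 f ∧ CondF2 f ∧ CondF3 f ∧ CondF5 f ∧ CondF6 f)) :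
    ∃ u : EuclideanSpace ℝ (Fin N) → ℝ, IsGroundState f u ∧ IsRadiallyDecreasing u := by
  obtain ⟨hN, h1, h2, h3, h5, h6⟩ : 1 ≤ N ∧ CondF1 f ∧ CondF2 f ∧ CondF3 f ∧ CondF5 f ∧
      CondF6 f := by
    rcases h with ⟨hN, h1, h2, h3, -, h5, h6⟩ | ⟨hN, h1, h2, h3, h5, h6⟩
    · exact ⟨by omega, h1, h2, h3, h5, h6⟩
    · exact ⟨by omega, h1, h2, h3, h5, h6⟩
  obtain ⟨n, rfl⟩ := Nat.exists_eq_add_of_le' hN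
  exact exists_groundState n h1 h2 h3 h5 h6
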